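/- **Setting.** There are $n$ bidders and $k\ge 1$ types of goods, each with supply $s\in\mathbb N$; bidder $i$ has a unit demand valuation $v_i=(v_{ij})_{j\in[k]}\in[0,1]^k$. The database is $(v_1,\dots,v_n)$; two databases are neighboring if they differ in the valuation of at most one bidder. A randomized algorithm $M$ is $\varepsilon$-differentially private if $\Pr[M(D)\in S]\le e^{\varepsilon}\Pr[M(D')\in S]$ for all neighboring $D,D'$ and all measurable sets $S$ of outputs. $\mathrm{Lap}(b)$ is the distribution on $\mathbb R$ with density $\frac1{2b}e^{-|x|/b}$. **The counter.** $\mathbf{Counter}(\varepsilon_0,N)$ (binary mechanism) keeps numbers $a_j,\hat a_j$ ($j\ge 0$), initially $0$. When it reads the $t$-th item $\sigma(t)\in\{0,1\}$ of its stream ($t=1,2,\dots$), let $i$ be the index of the lowest nonzero binary digit of $t$; it sets $a_i:=\sum_{j<i}a_j+\sigma(t)$, then $a_j:=\hat a_j:=0$ for $j<i$, and $\hat a_i:=a_i+\mathrm{Lap}(\log_2(N)/\varepsilon_0)$ with fresh independent noise. Its reading is then the sum of the $\hat a_j$ over the nonzero binary digits $j$ of $t$. Before the first item its reading is $0$. **The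 algorithm $\mathbf{PMatch}(\alpha,\rho,\varepsilon)$**, with $0<\alpha,\rho\le 1$, $\varepsilon>0$ and a failure parameter $\gamma>0$. Put $$T=\frac{8}{\alpha\rho},\qquad \varepsilon'=\frac{\varepsilon}{2T},\qquad E=\frac{2\sqrt2}{\varepsilon'}\,(\log_2 nT)^{5/2}\,\ln\!\Big(\frac{4k}{\gamma}\Big),\qquad m=2E+1 .$$ There are $k+1$ independent counters $\text{counter}(0),\dots,\text{counter}(k)$, all equal to $\mathbf{Counter}(\varepsilon',nT)$; $c_j$ denotes the current reading of $\text{counter}(j)$. Initially $p_j=0$ for every good $j$, and $\mu(i)=\emptyset$, $d_i=0$ for every bidder $i$. The algorithm performs $\lfloor T\rfloor$ rounds, unless it halts earlier. In each round: 1. *(Propose)* Bidders $i=1,\dots,n$ act in turn. If $\mu(i)=\emptyset$, bidder $i$ picks a good $j$ maximizing $v_{ij}-p_j$; ties are broken by an arbitrary fixed rule, which may depend on the round, the bidder, her own valuation and the current prices. If $v_{ij}-p_j\le 0$, set $\mu(i):=\perp$ and take the bid vector $b=\mathbf 0$; otherwise set $\mu(i):=j$, $d_i:=c_j$ and $b=\mathbf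 e_j$. If $\mu(i)\ne\emptyset$ at her turn, $b=\mathbf 0$. Then for each good $l$, $b_l$ is fed to $\text{counter}(l)$, and if the new reading satisfies $c_l\ge(p_l/\alpha+1)(s-m)$, then $p_l$ is increased by $\alpha$. 2. *(CountUnsatisfied)* For bidders $i=1,\dots,n$ in turn: if $\mu(i)$ is a good and $c_{\mu(i)}-d_i\ge s-m$, then $1$ is fed to $\text{counter}(0)$ and $\mu(i):=\emptyset$; otherwise $0$ is fed to $\text{counter}(0)$. 3. If during this round the reading of $\text{counter}(0)$ increased by less than $\rho n-2E$, the algorithm halts (and bidders with $\mu(i)=\emptyset$ get $\mu(i):=\perp$). **Released output.** The price vector after each bidder's turn in each round, and after each round the count of unsatisfied bidders, i.e. the reading of $\text{counter}(0)$ at the end of the round. **Theorem.** For every tie-breaking rule, the sequence of prices and counts of unsatisfied bidders released by $\mathbf{PMatch}(\alpha,\rho,\varepsilon)$ is $\varepsilon$-differentially private (as a function of the bidders' valuations). -/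

import Mathlib

/-- Two databases are neighbouring if they differ in at most one bidder's entry. -/
def Neighbouring {n : ℕ} {C : Type*} (D D' : Fin n → C) : Prop :=
  ∃ i, ∀ j, j ≠ i → D j = D' j

/-- A randomized algorithm, given as a function `M` of the database and of random coins
`ω : Ω` with law `P`, is `(ε, δ)`-differentially private. -/
def IsDifferentiallyPrivate {n : ℕ} {C Ω R : Type*} [MeasurableSpace Ω] [MeasurableSpace R]
    (P : MeasureTheory.Measure Ω) (M : (Fin n → C) → Ω → R) (ε δ : ℝ) : Prop :=
  ∀ D D' : Fin n → C, Neighbouring D D' → ∀ S : Set R, MeasurableSet S →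
    P {ω | M D ω ∈ S} ≤
      ENNReal.ofReal (Real.exp ε) * P {ω | M D' ω ∈ S} + ENNReal.ofReal δ

/-- The Laplace distribution `Lap(b)`, with density `exp (-|x| / b) / (2 b)`
(its variance is `2 b ^ 2`). -/
noncomputable def laplaceLaw (b : ℝ) : MeasureTheory.Measure ℝ :=
  MeasureTheory.volume.withDensity
    (fun x => ENNReal.ofReal (Real.exp (-|x| / b) / (2 * b)))

/-! ### The binary mechanism -/

/-- State of the binary mechanism: number of stream items read so far, exact partial sums `a`
and noisy partial sums `ahat`, indexed by their dyadic level. -/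
structure CounterState where
  time : ℕ
  a : ℕ → ℝ
  ahat : ℕ → ℝ

namespace CounterState

/-- The counter before any item was read. -/
def init : CounterState := ⟨0, fun _ => 0, fun _ => 0⟩

/-- One step of the binary mechanism: read the item `σ`, with fresh noise `ξ`.
The level `i = padicValNat 2 t` is the index of the lowest nonzero binary digit of the time `t`. -/
noncomputable def feed (c : CounterState) (σ ξ : ℝ) : CounterState :=
  let t := c.time + 1
  let i := padicValNat 2 t
  let ai := (∑ j ∈ Finset.range i, c.a j) + σ
  { time := t
    a := fun j => if j < i then 0 else if j = i then ai else c.a j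
    ahat := fun j => if j < i then 0 else if j = i then ai + ξ else c.ahat j }

/-- The current reading of the counter: the sum of the noisy partial sums at the levels of the
nonzero binary digits of the current time. -/
noncomputable def reading (c : CounterState) : ℝ :=
  ∑ j ∈ (Finset.range c.time.size).filter (fun j => c.time.testBit j = true), c.ahat j

end CounterState

/-- The noise scale of `Counter(ε, T)`: the noise on every partial sum is `Lap(log₂ T / ε)`. -/
noncomputable def counterScale (ε T : ℝ) : ℝ := Real.logb 2 T / ε

/-! ### The algorithm `PMatch` -/

/-- The assignment `μ(i)` of a bidder: none (`∅`), the dummy good `⊥`, or a good. -/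
inductive Assignment (k : ℕ) where
  | unmatched : Assignment k
  | dummy : Assignment k
  | good : Fin k → Assignment k

/-- A unit demand valuation: a value in `[0, 1]` for each of the `k` types of goods. -/
abbrev UnitDemand (k : ℕ) := Fin k → Set.Icc (0 : ℝ) 1

/-- The inputs of `PMatch` other than the valuations: `n` bidders, `k` types of goods, supply `s`,
price increment `α`, halting fraction `ρ`, privacy level `ε`, failure probability `γ`. -/
structure PMatchParams where
  n : ℕ
  k : ℕ
  s : ℕ
  α : ℝ
  ρ : ℝ
  ε : ℝ
  γ : ℝ

namespace PMatchParams

/-- `T = 8 / (α ρ)`. -/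
noncomputable def T (q : PMatchParams) : ℝ := 8 / (q.α * q.ρ)

/-- The number of proposing rounds: `T`, rounded down if it is not an integer. -/
noncomputable def rounds (q : PMatchParams) : ℕ := ⌊q.T⌋₊

/-- `ε' = ε / (2 T)`, the privacy parameter of each counter. -/
noncomputable def ε' (q : PMatchParams) : ℝ := q.ε / (2 * q.T)

/-- `E = (2 √2 / ε') (log (n T)) ^ (5/2) log (4 k / γ)`. -/
noncomputable def E (q : PMatchParams) : ℝ :=
  2 * Real.sqrt 2 / q.ε' * (Real.logb 2 (q.n * q.T)) ^ (5 / 2 : ℝ) * Real.log (4 * q.k / q.γ)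

/-- The reserved supply `m = 2 E + 1`. -/
noncomputable def m (q : PMatchParams) : ℝ := 2 * q.E + 1

/-- A rule that tells which favourite good a bidder bids on, depending on the round, the bidder,
her valuation, and the current prices. Ties may be broken arbitrarily. -/
def IsFavouriteRule (q : PMatchParams)
    (sel : ℕ → Fin q.n → UnitDemand q.k → (Fin q.k → ℝ) → Fin q.k) : Prop :=
  ∀ (r : ℕ) (i : Fin q.n) (v : UnitDemand q.k) (p : Fin q.k → ℝ) (j : Fin q.k),
    (v j : ℝ) - p j ≤ (v (sel r i v p) : ℝ) - p (sel r i v p)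

/-- Internal state of `PMatch`. The price of good `j` is `level j` increments of size `α`. -/
structure State (q : PMatchParams) where
  μ : Fin q.n → Assignment q.k
  d : Fin q.n → ℝ
  level : Fin q.k → ℕ
  counter : Fin q.k → CounterState
  counter0 : CounterState
  halted : Prop

/-- The initial state. -/
def State.init (q : PMatchParams) : q.State where
  μ := fun _ => .unmatched
  d := fun _ => 0
  level := fun _ => 0
  counter := fun _ => CounterState.init
  counter0 := CounterState.init
  halted := False

/-- The current price vector `p`. -/
noncomputable def State.price {q : PMatchParams} (S : q.State) (j : Fin q.k) : ℝ :=
  q.α * S.level j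

/-- `Bid`: feed `b j` to the counter of every good `j`, with fresh noise `ξ j`, and raise the
price of `j` by `α` if the new count `c j` is at least `(p j / α + 1) (s - m)`. -/
noncomputable def State.bid {q : PMatchParams} (S : q.State) (b ξ : Fin q.k → ℝ) : q.State :=
  open scoped Classical in
  { S with
    counter := fun j => (S.counter j).feed (b j) (ξ j)
    level := fun j =>
      if ((S.level j : ℝ) + 1) * (q.s - q.m) ≤ ((S.counter j).feed (b j) (ξ j)).reading
      then S.level j + 1 else S.level j }

/-- The turn of bidder `i` in `Propose` of round `r`. Nothing happens after the algorithm halted. -/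
noncomputable def State.propose {q : PMatchParams} (S : q.State)
    (sel : ℕ → Fin q.n → UnitDemand q.k → (Fin q.k → ℝ) → Fin q.k)
    (v : Fin q.n → UnitDemand q.k) (r : ℕ) (i : Fin q.n) (ξ : Fin q.k → ℝ) : q.State :=
  open scoped Classical in
  if S.halted then S else
  match S.μ i with
  | .unmatched =>
    let j := sel r i (v i) S.price
    if (v i j : ℝ) - S.price j ≤ 0 then
      State.bid { S with μ := Function.update S.μ i .dummy } 0 ξ
    else
      State.bid { S with
        μ := Function.update S.μ i (.good j)
        d := Function.update S.d i (S.counter j).reading } (Pi.single j 1) ξ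
  | _ => S.bid 0 ξ

/-- Bidder `i` is matched to a good `j` with `c j - d i ≥ s - m`, that is, she was outbid. -/
def State.Outbid {q : PMatchParams} (S : q.State) (i : Fin q.n) : Prop :=
  ∃ j, S.μ i = .good j ∧ (q.s : ℝ) - q.m ≤ (S.counter j).reading - S.d i

/-- The turn of bidder `i` in `CountUnsatisfied`, with fresh noise `ξ` for `counter(0)`. -/
noncomputable def State.report {q : PMatchParams} (S : q.State) (i : Fin q.n) (ξ : ℝ) : q.State :=
  open scoped Classical in
  if S.halted then S else
  if S.Outbid i then
    { S with μ := Function.update S.μ i .unmatched, counter0 := S.counter0.feed 1 ξ }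
  else
    { S with counter0 := S.counter0.feed 0 ξ }

/-- The random coins: every counter (`some j` for good `j`, `none` for `counter(0)`) reads one
item per round and bidder, and uses one fresh noise variable for it. -/
abbrev Noise (q : PMatchParams) := Option (Fin q.k) × Fin q.rounds × Fin q.n → ℝ

/-- The law of the coins: independent `Lap(log₂ (n T) / ε')` variables, that is, all counters are
`Counter(ε', n T)`. -/
noncomputable def noiseLaw (q : PMatchParams) : MeasureTheory.Measure q.Noise :=
  MeasureTheory.Measure.pi (fun _ => laplaceLaw (counterScale q.ε' (q.n * q.T)))

/-- The state after the first `l` bidders had their turn in `Propose` of round `r`, where `S` is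
the state before the round. -/
noncomputable def afterProposals (q : PMatchParams)
    (sel : ℕ → Fin q.n → UnitDemand q.k → (Fin q.k → ℝ) → Fin q.k)
    (v : Fin q.n → UnitDemand q.k) (ω : q.Noise) (r : Fin q.rounds) (S : q.State) : ℕ → q.State
  | 0 => S
  | l + 1 =>
    if h : l < q.n then
      (afterProposals q sel v ω r S l).propose sel v r ⟨l, h⟩ (fun j => ω (some j, r, ⟨l, h⟩))
    else afterProposals q sel v ω r S l

/-- The state after the first `l` bidders had their turn in `CountUnsatisfied` of round `r`, where
`S` is the state at the end of `Propose`. -/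
noncomputable def afterReports (q : PMatchParams) (ω : q.Noise) (r : Fin q.rounds)
    (S : q.State) : ℕ → q.State
  | 0 => S
  | l + 1 =>
    if h : l < q.n then
      (afterReports q ω r S l).report ⟨l, h⟩ (ω (none, r, ⟨l, h⟩))
    else afterReports q ω r S l

/-- The halting test at the end of a round, where `S` is the state before the round and `S'` the
state at its end: halt if `counter(0)` increased by less than `ρ n - 2 E`, and then
match the unmatched bidders to `⊥`. -/
noncomputable def haltTest (q : PMatchParams) (S S' : q.State) : q.State :=
  open scoped Classical in
  if S'.halted then S' else
  if S'.counter0.reading - S.counter0.reading < q.ρ * q.n - 2 * q.E then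
    { S' with
      halted := True
      μ := fun i => match S'.μ i with
        | .unmatched => .dummy
        | x => x }
  else S'

/-- One complete round: `Propose` for all bidders, `CountUnsatisfied`, and the halting test. -/
noncomputable def round (q : PMatchParams)
    (sel : ℕ → Fin q.n → UnitDemand q.k → (Fin q.k → ℝ) → Fin q.k)
    (v : Fin q.n → UnitDemand q.k) (ω : q.Noise) (r : Fin q.rounds) (S : q.State) : q.State :=
  q.haltTest S (q.afterReports ω r (q.afterProposals sel v ω r S q.n) q.n)

/-- The state after `r` rounds. -/
noncomputable def afterRounds (q : PMatchParams)
    (sel : ℕ → Fin q.n → UnitDemand q.k → (Fin q.k → ℝ) → Fin q.k)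
    (v : Fin q.n → UnitDemand q.k) (ω : q.Noise) : ℕ → q.State
  | 0 => State.init q
  | r + 1 =>
    if h : r < q.rounds then
      q.round sel v ω ⟨r, h⟩ (afterRounds q sel v ω r)
    else afterRounds q sel v ω r

/-- The public output of `PMatch`: the price vector after each turn of each bidder in each round,
and the noisy count of unsatisfied bidders, that is the reading of `counter(0)`, after each round.
If the algorithm halts early, the remaining entries repeat the last ones. (The round of halting is
itself determined by the released counts.) -/
noncomputable def released (q : PMatchParams)
    (sel : ℕ → Fin q.n → UnitDemand q.k → (Fin q.k → ℝ) → Fin q.k)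
    (v : Fin q.n → UnitDemand q.k) (ω : q.Noise) :
    (Fin q.rounds → Fin q.n → Fin q.k → ℝ) × (Fin q.rounds → ℝ) :=
  (fun r i => (q.afterProposals sel v ω r (q.afterRounds sel v ω r) (i + 1)).price,
   fun r => (q.afterRounds sel v ω (r + 1)).counter0.reading)

end PMatchParams

/-! Neighbouring databases v, v' are compared at a fixed vector η of noisy partial sums, not at a
fixed noise vector ω. Given η, every public reading is known, so each bidder acts on η and her own
valuation alone; hence the released output is a function of η that does not see the valuation of the
changed bidder i₀ (`agreeExcept_driven`, `drivenReleased_congr`). For each v the noise is recovered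
as ω = η - B_v(η), where B_v (`drivenSums`) lists the exact partial sums. Each sum depends only on
the coordinates of η from earlier turns, so this map is a bijection. Since B_v is integer valued, it
is a countable patchwork of translations, and replacing v by v' costs a factor exp(K/b), where K
bounds the ℓ¹ distance of B_v and B_v' (`pi_laplaceLaw_image_sub_le`).

The noise scale is b = 2T log₂(nT)/ε, so it suffices that K ≤ 2RL with R = ⌊T⌋ and L = ⌊log₂(nR)⌋
(`sum_abs_drivenSums_sub_le`). For fixed η only the items of i₀ differ. The item at position u
enters at most one partial sum for each zero among the digits 0, …, L of u, hence at most L sums if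
u ≠ 0. After the first round she bids only if she reported in the round before: if both runs report,
the reports cancel and the next bids differ in at most two items; if one does, one report and at
most one bid differ. So a round costs two items.

The boundary terms (first bids, last report, position 0) must fit into the same budget. Partial sums
of counter(0) that no round-end reading uses are left out of B_v, so the last report touches a
single sum; and positions that are not powers of two have a second nonzero digit, which happens
often enough because R ≥ 8 (`sum_zeroDigits_le`). -/

open MeasureTheory

/-! ### Shifting product Laplace noise. -/

/-- The triangle inequality bounds the ratio of the two densities pointwise. As an inequality
between measures the bound passes to products. -/
theorem laplaceLaw_le_map_add {b : ℝ} (hb : 0 < b) (w : ℝ) :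
    laplaceLaw b ≤ ENNReal.ofReal (Real.exp (|w| / b)) • (laplaceLaw b).map (· + w) := by
  have hm0 : Measurable fun x : ℝ => ENNReal.ofReal (Real.exp (-|x| / b) / (2 * b)) := by fun_prop
  refine Measure.le_iff.2 fun s hs => ?_
  rw [Measure.smul_apply, Measure.map_apply (measurable_add_const w) hs, laplaceLaw,
    withDensity_apply _ hs, withDensity_apply _ (measurable_add_const w hs), smul_eq_mul,
    ← lintegral_indicator hs, ← lintegral_indicator (measurable_add_const w hs),
    ← lintegral_sub_right_eq_self (((· + w) ⁻¹' s).indicator _) w, ← lintegral_const_mul]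
  · refine lintegral_mono fun x => ?_
    by_cases hx : x ∈ s
    · rw [Set.indicator_of_mem hx, Set.indicator_of_mem (by simpa using hx),
        ← ENNReal.ofReal_mul (Real.exp_pos _).le]
      refine ENNReal.ofReal_le_ofReal ?_
      rw [← mul_div_assoc, ← Real.exp_add]
      gcongr
      rw [← add_div]
      gcongr
      have h := abs_sub_abs_le_abs_sub (x - w) x
      rw [show x - w - x = -w by ring, abs_neg] at h
      linarith
    · rw [Set.indicator_of_notMem hx]
      exact zero_le
  · have := (hm0.indicator (measurable_add_const w hs)).comp (measurable_id.sub_const w)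
    exact this

theorem laplaceLaw_map_add_le {b : ℝ} (hb : 0 < b) (z z' : ℝ) :
    (laplaceLaw b).map (· + z) ≤
      ENNReal.ofReal (Real.exp (|z - z'| / b)) • (laplaceLaw b).map (· + z') := by
  have h := Measure.map_mono (laplaceLaw_le_map_add hb (z' - z)) (measurable_add_const z)
  rw [Measure.map_smul, Measure.map_map (measurable_add_const z) (measurable_add_const _)] at h
  rw [abs_sub_comm]
  convert h using 3
  ext x; simp only [Function.comp_apply]; ring

instance laplaceLaw.sigmaFinite (b : ℝ) : SigmaFinite (laplaceLaw b) :=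
  SigmaFinite.withDensity_ofReal _

/-- `Measure.pi` comes from the largest outer measure bounded on boxes by the product of the side
measures, and the left measure divided by the constant is one such outer measure. The division is
why the constants must be nonzero and finite. -/
theorem MeasureTheory.Measure.pi_le_smul_pi {ι : Type*} [Fintype ι] {α : ι → Type*}
    [∀ i, MeasurableSpace (α i)] (μ ν : ∀ i, Measure (α i)) [∀ i, SigmaFinite (μ i)]
    [∀ i, SigmaFinite (ν i)] (c : ι → ENNReal) (hc : ∀ i, c i ≠ 0) (hc' : ∀ i, c i ≠ ⊤)
    (h : ∀ i, μ i ≤ c i • ν i) : Measure.pi μ ≤ (∏ i, c i) • Measure.pi ν := by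
  have hC : (∏ i, c i) ≠ 0 := Finset.prod_ne_zero_iff.2 fun i _ => hc i
  have hC' : (∏ i, c i) ≠ ⊤ := ENNReal.prod_ne_top fun i _ => hc' i
  have key : ((∏ i, c i)⁻¹ • Measure.pi μ).toOuterMeasure ≤
      OuterMeasure.pi fun i => (ν i).toOuterMeasure := by
    rw [OuterMeasure.le_pi]
    intro s _
    change (∏ i, c i)⁻¹ * Measure.pi μ (Set.univ.pi s) ≤ ∏ i, ν i (s i)
    rw [Measure.pi_pi, ENNReal.inv_mul_le_iff hC hC', ← Finset.prod_mul_distrib]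
    exact Finset.prod_le_prod' fun i _ => h i (s i)
  refine Measure.le_iff.2 fun s hs => ?_
  have h1 := key s
  change (∏ i, c i)⁻¹ * Measure.pi μ s ≤ _ at h1
  rw [ENNReal.inv_mul_le_iff hC hC'] at h1
  rw [Measure.smul_apply, smul_eq_mul]
  refine h1.trans (mul_le_mul_right ?_ _)
  rw [Measure.pi, toMeasure_apply _ _ hs]

theorem pi_laplaceLaw_add_preimage_le {ι : Type*} [Fintype ι] {b : ℝ} (hb : 0 < b)
    (z z' : ι → ℝ) {U : Set (ι → ℝ)} (hU : MeasurableSet U) :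
    Measure.pi (fun _ : ι => laplaceLaw b) ((· + z) ⁻¹' U) ≤
      ENNReal.ofReal (Real.exp ((∑ i, |z i - z' i|) / b)) *
        Measure.pi (fun _ : ι => laplaceLaw b) ((· + z') ⁻¹' U) := by
  have hsf : ∀ z : ℝ, SigmaFinite ((laplaceLaw b).map (· + z)) := fun z =>
    (MeasurableEquiv.addRight z).sigmaFinite_map
  have hmap : ∀ z : ι → ℝ, (Measure.pi fun _ : ι => laplaceLaw b).map (· + z) =
      Measure.pi fun i => (laplaceLaw b).map (· + z i) := fun z =>
    Measure.pi_map_pi fun i => (measurable_add_const (z i)).aemeasurable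
  have h := Measure.pi_le_smul_pi (fun i => (laplaceLaw b).map (· + z i))
    (fun i => (laplaceLaw b).map (· + z' i)) _
    (fun i => by simp [Real.exp_pos]) (fun i => ENNReal.ofReal_ne_top)
    (fun i => laplaceLaw_map_add_le hb (z i) (z' i)) U
  rw [← hmap, ← hmap, Measure.smul_apply, Measure.map_apply (measurable_add_const z) hU,
    Measure.map_apply (measurable_add_const z') hU, smul_eq_mul,
    ← ENNReal.ofReal_prod_of_nonneg fun _ _ => (Real.exp_pos _).le, ← Real.exp_sum,
    ← Finset.sum_div] at h
  exact h

/-- If two noise vectors are obtained from the same published vector by subtracting integer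
valued corrections at `ℓ¹` distance at most `K`, then publishing events have probabilities
within a factor `exp (K / b)`. -/
theorem pi_laplaceLaw_image_sub_le {ι : Type*} [Fintype ι] {b K : ℝ} (hb : 0 < b)
    {B B' : (ι → ℝ) → ι → ℝ} (hB : Measurable B) (hB' : Measurable B')
    (hZ : ∀ η c, ∃ z : ℤ, B η c = z) (hZ' : ∀ η c, ∃ z : ℤ, B' η c = z)
    (hinj : Function.Injective fun η => η - B' η)
    (hK : ∀ η, ∑ c, |B η c - B' η c| ≤ K) {U : Set (ι → ℝ)} (hU : MeasurableSet U) :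
    Measure.pi (fun _ : ι => laplaceLaw b) ((fun η => η - B η) '' U) ≤
      ENNReal.ofReal (Real.exp (K / b)) *
        Measure.pi (fun _ : ι => laplaceLaw b) ((fun η => η - B' η) '' U) := by
  set P := Measure.pi (fun _ : ι => laplaceLaw b)
  -- On each piece both corrections are constant, so both images are translates of the piece;
  -- integrality makes the pieces countable in number.
  let V : (ι → ℤ) × (ι → ℤ) → Set (ι → ℝ) := fun p =>
    U ∩ (B ⁻¹' {fun c => (p.1 c : ℝ)} ∩ B' ⁻¹' {fun c => (p.2 c : ℝ)})
  have hV : ∀ p, MeasurableSet (V p) := fun p =>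
    hU.inter ((hB (measurableSet_singleton _)).inter (hB' (measurableSet_singleton _)))
  calc P ((fun η => η - B η) '' U)
      ≤ P (⋃ p, (· + fun c => ((p.1 c : ℤ) : ℝ)) ⁻¹' V p) := by
        refine measure_mono ?_
        rintro _ ⟨η, hη, rfl⟩
        choose z hz using hZ η
        choose z' hz' using hZ' η
        refine Set.mem_iUnion.2 ⟨(z, z'), ?_⟩
        have e : η - B η + (fun c => ((z c : ℤ) : ℝ)) = η := by
          ext c; simp [hz]
        simp only [Set.mem_preimage, e]
        exact ⟨hη, funext hz, funext hz'⟩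
    _ ≤ ∑' p, P ((· + fun c => ((p.1 c : ℤ) : ℝ)) ⁻¹' V p) := measure_iUnion_le _
    _ ≤ ∑' p, ENNReal.ofReal (Real.exp (K / b)) *
          P ((· + fun c => ((p.2 c : ℤ) : ℝ)) ⁻¹' V p) := by
        refine ENNReal.tsum_le_tsum fun p => ?_
        rcases (V p).eq_empty_or_nonempty with h | ⟨η, -, h1, h2⟩
        · simp [h]
        · refine (pi_laplaceLaw_add_preimage_le hb _ (fun c => ((p.2 c : ℤ) : ℝ)) (hV p)).trans ?_
          gcongr
          refine le_trans (le_of_eq ?_) (hK η)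
          rw [Set.mem_preimage, Set.mem_singleton_iff] at h1 h2
          rw [h1, h2]
    _ = ENNReal.ofReal (Real.exp (K / b)) *
          P (⋃ p, (· + fun c => ((p.2 c : ℤ) : ℝ)) ⁻¹' V p) := by
        rw [ENNReal.tsum_mul_left, measure_iUnion]
        -- Injectivity keeps the translated pieces disjoint, so their measures add up to that of the
        -- union. On the `B` side a union bound was enough.
        · intro p p' hpp
          refine Set.disjoint_left.2 fun ω h h' => hpp ?_
          obtain ⟨-, h1, h2⟩ := h
          obtain ⟨-, h1', h2'⟩ := h'
          simp only [Set.mem_preimage, Set.mem_singleton_iff] at h1 h2 h1' h2'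
          have e : (ω + fun c => ((p.2 c : ℤ) : ℝ)) = ω + fun c => ((p'.2 c : ℤ) : ℝ) :=
            hinj (by simp only [h2, h2', add_sub_cancel_right])
          rw [e] at h1 h2
          refine Prod.ext (funext fun c => ?_) (funext fun c => ?_)
          · exact_mod_cast congrFun (h1.symm.trans h1') c
          · exact_mod_cast congrFun (h2.symm.trans h2') c
        · exact fun p => measurable_add_const _ (hV p)
    _ ≤ _ := by
        refine mul_le_mul_right (measure_mono ?_) _
        refine Set.iUnion_subset fun p ω h => ?_
        refine ⟨_, h.1, ?_⟩
        have h2 := h.2.2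
        simp only [Set.mem_preimage, Set.mem_singleton_iff] at h2
        simp only [h2, add_sub_cancel_right]

/-! ### Dyadic blocks and binary digits. -/

/-- The (zero-based) stream positions summed up by the partial sum which the binary mechanism
creates at time `t`. -/
def dyadicBlock (t : ℕ) : Finset ℕ := Finset.Ico (t - 2 ^ padicValNat 2 t) t

/-- The number of zeros among the binary digits `0, …, L` of `x`. -/
def zeroDigits (L x : ℕ) : ℕ := ((Finset.range (L + 1)).filter fun i => x.testBit i = false).card

theorem exists_odd_eq_two_pow_padicValNat_mul {t : ℕ} (ht : t ≠ 0) :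
    ∃ m, t = 2 ^ padicValNat 2 t * (2 * m + 1) := by
  obtain ⟨m, hm⟩ := pow_padicValNat_dvd (p := 2) (n := t)
  have h := pow_succ_padicValNat_not_dvd (p := 2) ht
  rcases Nat.even_or_odd' m with ⟨c, rfl | rfl⟩
  · refine absurd ?_ h
    rw [pow_succ]
    exact ⟨c, by rw [mul_assoc]; exact hm⟩
  · exact ⟨c, hm⟩

/-- Since t is an odd multiple of 2^i, its block is [2^i · 2m, 2^i · (2m+1)). -/
theorem div_two_pow_of_mem_dyadicBlock {t u : ℕ} (h : u ∈ dyadicBlock t) :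
    ∃ m, t = 2 ^ padicValNat 2 t * (2 * m + 1) ∧ u / 2 ^ padicValNat 2 t = 2 * m := by
  obtain ⟨h1, h2⟩ := Finset.mem_Ico.1 h
  obtain ⟨m, hm⟩ := exists_odd_eq_two_pow_padicValNat_mul (t := t) (by omega)
  refine ⟨m, hm, ?_⟩
  generalize padicValNat 2 t = i at *
  have hp : 0 < 2 ^ i := by positivity
  have e : 2 ^ i * (2 * m + 1) = 2 ^ i * (2 * m) + 2 ^ i := by ring
  rw [Nat.div_eq_iff hp]
  constructor
  · rw [mul_comm]; omega
  · rw [mul_comm]; omega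

/-- A block containing u is determined by its level i, and i must be a zero digit of u because u /
2^i is even. The usual count L + 1 would be too weak for the final constant. -/
theorem card_dyadicBlock_mem_le {N L : ℕ} (hN : N < 2 ^ (L + 1)) (u : ℕ) :
    ((Finset.Icc 1 N).filter fun t => u ∈ dyadicBlock t).card ≤ zeroDigits L u := by
  refine Finset.card_le_card_of_injOn (padicValNat 2) ?_ ?_
  · intro t ht
    simp only [Finset.coe_filter, Finset.mem_Icc, Set.mem_ofPred_eq] at ht
    obtain ⟨m, hm, hu⟩ := div_two_pow_of_mem_dyadicBlock ht.2
    simp only [Finset.coe_filter, Finset.mem_range, Set.mem_ofPred_eq]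
    constructor
    · refine (Nat.pow_lt_pow_iff_right (a := 2) (by norm_num)).1 (lt_of_le_of_lt ?_ hN)
      exact (Nat.le_of_dvd (by omega) pow_padicValNat_dvd).trans ht.1.2
    · rw [Nat.testBit_eq_decide_div_mod_eq, hu]
      simp
  · intro t ht t' ht' h
    simp only [Finset.coe_filter, Finset.mem_Icc, Set.mem_ofPred_eq] at ht ht'
    obtain ⟨m, hm, hu⟩ := div_two_pow_of_mem_dyadicBlock ht.2
    obtain ⟨m', hm', hu'⟩ := div_two_pow_of_mem_dyadicBlock ht'.2
    rw [← h] at hu' hm'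
    rw [hm, hm', ← hu, ← hu']

/-- The partial sum created at time `s` is used by the reading at time `N`. -/
def IsUsedAt (s N : ℕ) : Prop := s ≤ N ∧ N < s + 2 ^ padicValNat 2 s

theorem eq_of_isUsedAt_of_mem_dyadicBlock {N s s' u : ℕ} (hs : IsUsedAt s N) (hs' : IsUsedAt s' N)
    (hu : u ∈ dyadicBlock s) (hu' : u ∈ dyadicBlock s') : s = s' := by
  wlog h : padicValNat 2 s ≤ padicValNat 2 s' generalizing s s'
  · exact (this hs' hs hu' hu (by omega)).symm
  obtain ⟨m, hm, hd⟩ := div_two_pow_of_mem_dyadicBlock hu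
  obtain ⟨m', hm', hd'⟩ := div_two_pow_of_mem_dyadicBlock hu'
  rcases h.eq_or_lt with h | h
  · rw [← h, hd] at hd'
    rw [hm, hm', ← h, hd']
  · obtain ⟨d, hd⟩ := Nat.exists_eq_add_of_lt h
    obtain ⟨h1, h2⟩ := hs
    obtain ⟨h3, h4⟩ := hs'
    have h5 := Finset.mem_Ico.1 hu
    have h6 := Finset.mem_Ico.1 hu'
    rw [hd] at hm'
    generalize padicValNat 2 s = i at *
    have hp : 0 < 2 ^ i := by positivity
    have e' : s' = 2 ^ i * (2 * (2 ^ d * (2 * m' + 1))) := by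
      rw [hm', pow_add, pow_add]; ring
    -- Now s is an odd and s' an even multiple of 2^i. If s < s', the sum made at s is discarded by
    -- time s'; if s' < s, the block of s starts at or after s'.
    generalize 2 ^ d * (2 * m' + 1) = k at e'
    rcases Nat.lt_or_ge m k with hmk | hmk
    · have : 2 ^ i * (2 * m + 1) + 2 ^ i ≤ 2 ^ i * (2 * k) := by
        rw [← Nat.mul_succ]; exact Nat.mul_le_mul_left _ (by omega)
      omega
    · have : 2 ^ i * (2 * k) + 2 ^ i ≤ 2 ^ i * (2 * m + 1) := by
        rw [← Nat.mul_succ]; exact Nat.mul_le_mul_left _ (by omega)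
      omega

theorem zeroDigits_le (L x : ℕ) : zeroDigits L x ≤ L + 1 :=
  (Finset.card_filter_le _ _).trans (by simp)

theorem lt_of_testBit_of_lt {L x i : ℕ} (hx : x < 2 ^ (L + 1)) (h : x.testBit i = true) :
    i < L + 1 :=
  (Nat.pow_lt_pow_iff_right (a := 2) (by norm_num)).1 ((Nat.ge_two_pow_of_testBit h).trans_lt hx)

theorem zeroDigits_add_card_le {L x : ℕ} (s : Finset ℕ) (hx : x < 2 ^ (L + 1))
    (hs : ∀ i ∈ s, x.testBit i = true) : zeroDigits L x + s.card ≤ L + 1 := by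
  have h := Finset.card_filter_add_card_filter_not (s := Finset.range (L + 1))
    (fun i => x.testBit i = false)
  rw [Finset.card_range] at h
  refine le_trans (Nat.add_le_add_left (Finset.card_le_card fun i hi => ?_) _) h.le
  simp [lt_of_testBit_of_lt hx (hs i hi), hs i hi]

theorem zeroDigits_le_of_ne_zero {L x : ℕ} (hx : x < 2 ^ (L + 1)) (h0 : x ≠ 0) :
    zeroDigits L x ≤ L := by
  obtain ⟨i, hi⟩ := Nat.exists_testBit_of_ne_zero h0
  have := zeroDigits_add_card_le {i} hx (by simpa using hi)
  simpa using this

theorem zeroDigits_lt_of_ne_two_pow {L x : ℕ} (hx : x < 2 ^ (L + 1)) (h0 : x ≠ 0)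
    (h : ∀ a, x ≠ 2 ^ a) : zeroDigits L x + 1 ≤ L := by
  obtain ⟨i, hi⟩ := Nat.exists_testBit_of_ne_zero h0
  have : ∃ j, j ≠ i ∧ x.testBit j = true := by
    by_contra! hc
    refine h i (Nat.eq_of_testBit_eq fun j => ?_)
    rw [Nat.testBit_two_pow]
    by_cases hj : i = j
    · subst hj; simpa using hi
    · simpa [hj] using hc j (Ne.symm hj)
  obtain ⟨j, hj, hj'⟩ := this
  have := zeroDigits_add_card_le {i, j} hx (by simpa using ⟨hi, hj'⟩)
  rw [Finset.card_pair hj.symm] at this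
  omega

theorem mul_ne_two_pow_of_odd_prime_dvd {p m : ℕ} (hp : p.Prime) (hp2 : p ≠ 2) (h : p ∣ m) (a : ℕ) :
    m ≠ 2 ^ a := by
  rintro rfl
  exact hp2 ((Nat.prime_dvd_prime_iff_eq hp Nat.prime_two).1 (hp.dvd_of_dvd_pow h))

/-- No three powers of two form an arithmetic progression with nonzero difference. -/
theorem not_two_pow_arith_progression {d a b c : ℕ} (hd : 0 < d) (h1 : 2 ^ b = 2 ^ a + d)
    (h2 : 2 ^ c = 2 ^ b + d) : False := by
  have hab : a < b := (Nat.pow_lt_pow_iff_right (a := 2) (by norm_num)).1 (by omega)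
  have hbc : b < c := (Nat.pow_lt_pow_iff_right (a := 2) (by norm_num)).1 (by omega)
  have h3 : 2 * 2 ^ b ≤ 2 ^ c := by
    rw [← pow_succ']; exact Nat.pow_le_pow_right (by norm_num) hbc
  have := Nat.two_pow_pos a
  omega

/-- Bounding by L at every nonzero position overshoots by 1 if i > 0, and by 4 if i = 0, where
position 0 has L + 1 zeros and occurs three times. Positions with two nonzero digits within the
first eight rounds win this back. -/
theorem sum_zeroDigits_le {n R L i : ℕ} (hR : 8 ≤ R) (hi : i < n) (hN : n * R < 2 ^ (L + 1)) :
    2 * zeroDigits L i + 1 + ∑ r ∈ Finset.range (R - 1),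
      (zeroDigits L (n * (r + 1) + i) + max (zeroDigits L (n * (r + 1) + i))
        (zeroDigits L (n * r + i))) ≤ 2 * R * L := by
  obtain ⟨q, rfl⟩ := Nat.exists_eq_add_of_le hR
  have hlt : ∀ r, r < 8 + q → n * r + i < 2 ^ (L + 1) := fun r hr => by
    have : n * (r + 1) ≤ n * (8 + q) := Nat.mul_le_mul_left _ hr
    rw [Nat.mul_succ] at this
    omega
  have hL : ∀ r, r + 1 < 8 + q → zeroDigits L (n * (r + 1) + i) ≤ L := fun r hr =>
    zeroDigits_le_of_ne_zero (hlt _ hr) (by rw [Nat.mul_succ]; omega)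
  have hL' : ∀ r, r + 1 < 8 + q → (∀ a, n * (r + 1) + i ≠ 2 ^ a) →
      zeroDigits L (n * (r + 1) + i) + 1 ≤ L := fun r hr =>
    zeroDigits_lt_of_ne_two_pow (hlt _ hr) (by rw [Nat.mul_succ]; omega)
  rw [show 8 + q - 1 = 7 + q by omega, Finset.sum_range_add]
  have htail : ∑ r ∈ Finset.range q, (zeroDigits L (n * (7 + r + 1) + i) +
      max (zeroDigits L (n * (7 + r + 1) + i)) (zeroDigits L (n * (7 + r) + i))) ≤ q * (2 * L) := by
    refine (Finset.sum_le_card_nsmul _ _ (2 * L) fun r hr => ?_).trans (by simp)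
    have := Finset.mem_range.1 hr
    have h1 := hL (7 + r) (by omega)
    have h2 := hL (6 + r) (by omega)
    rw [show 6 + r + 1 = 7 + r by omega] at h2
    omega
  have h1 := hL 0 (by omega)
  have h2 := hL 1 (by omega)
  have h3 := hL 2 (by omega)
  have h4 := hL 3 (by omega)
  have h5 := hL 4 (by omega)
  have h6 := hL 5 (by omega)
  have h7 := hL 6 (by omega)
  have key : 2 * zeroDigits L i + 1 + ∑ r ∈ Finset.range 7,
      (zeroDigits L (n * (r + 1) + i) + max (zeroDigits L (n * (r + 1) + i))
        (zeroDigits L (n * r + i))) ≤ 16 * L := by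
    simp only [Finset.sum_range_succ, Finset.sum_range_zero]
    norm_num only at h1 h2 h3 h4 h5 h6 h7 ⊢
    rcases Nat.eq_zero_or_pos i with rfl | hi0
    -- 3n, 5n, 6n and 7n have an odd prime factor, so each saves at least 1.
    · have k3 := hL' 2 (by omega) fun a =>
        mul_ne_two_pow_of_odd_prime_dvd Nat.prime_three (by norm_num) ⟨n, by ring⟩ a
      have k5 := hL' 4 (by omega) fun a =>
        mul_ne_two_pow_of_odd_prime_dvd Nat.prime_five (by norm_num) ⟨n, by ring⟩ a
      have k6 := hL' 5 (by omega) fun a =>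
        mul_ne_two_pow_of_odd_prime_dvd Nat.prime_three (by norm_num) ⟨2 * n, by ring⟩ a
      have k7 := hL' 6 (by omega) fun a =>
        mul_ne_two_pow_of_odd_prime_dvd Nat.prime_seven (by norm_num) ⟨n, by ring⟩ a
      have h0 := zeroDigits_le L (n * 0 + 0)
      have h0' := zeroDigits_le L 0
      norm_num only at k3 k5 k6 k7
      omega
    · have h0 := zeroDigits_le_of_ne_zero (hlt 0 (by omega)) (by omega)
      have h0' : zeroDigits L i ≤ L := by simpa using h0
      -- One saving suffices: n + i, 2n + i, 3n + i are in arithmetic progression and cannot all be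
      -- powers of two.
      have : zeroDigits L (n * 1 + i) + 1 ≤ L ∨ zeroDigits L (n * 2 + i) + 1 ≤ L ∨
          zeroDigits L (n * 3 + i) + 1 ≤ L := by
        by_contra! hc
        obtain ⟨c1, c2, c3⟩ := hc
        have d1 : ∃ a, n * 1 + i = 2 ^ a := by
          by_contra! h; have := hL' 0 (by omega) h; norm_num only at this; omega
        have d2 : ∃ a, n * 2 + i = 2 ^ a := by
          by_contra! h; have := hL' 1 (by omega) h; norm_num only at this; omega
        have d3 : ∃ a, n * 3 + i = 2 ^ a := by
          by_contra! h; have := hL' 2 (by omega) h; norm_num only at this; omega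
        obtain ⟨a, ha⟩ := d1
        obtain ⟨b, hb⟩ := d2
        obtain ⟨c, hc⟩ := d3
        exact not_two_pow_arith_progression (d := n) (a := a) (b := b) (c := c) (by omega)
          (by omega) (by omega)
      omega
  nlinarith [htail, key]

/-- Here `g r` counts the differing bid items of round r, `e` and `e'` are the reports in the two
runs, and `V r` counts the relevant sums that contain the report. For e = e' = 1 the next bids cost
twice the weight at round r + 1; for e ≠ e' they cost it once, plus the report's weight at round r.
The `max` covers both cases. -/
theorem weighted_items_le {n R L i : ℕ} (hR : 8 ≤ R) (hi : i < n) (hN : n * R < 2 ^ (L + 1))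
    {g e e' V : ℕ → ℝ} (he : ∀ r, e r = 0 ∨ e r = 1) (he' : ∀ r, e' r = 0 ∨ e' r = 1)
    (hg0 : g 0 ≤ 2) (hg : ∀ r, r + 1 < R → g (r + 1) ≤ e r + e' r)
    (hV : ∀ r, V r ≤ zeroDigits L (n * r + i)) (hV1 : V (R - 1) ≤ 1) :
    ∑ r ∈ Finset.range R, zeroDigits L (n * r + i) * g r +
      ∑ r ∈ Finset.range R, V r * |e r - e' r| ≤ 2 * R * L := by
  obtain ⟨R', rfl⟩ : ∃ R', R = R' + 1 := ⟨R - 1, by omega⟩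
  have key : ((2 * zeroDigits L i + 1 + ∑ r ∈ Finset.range (R' + 1 - 1),
      (zeroDigits L (n * (r + 1) + i) + max (zeroDigits L (n * (r + 1) + i))
        (zeroDigits L (n * r + i))) : ℕ) : ℝ) ≤ ((2 * (R' + 1) * L : ℕ) : ℝ) :=
    Nat.cast_le.2 (sum_zeroDigits_le hR hi hN)
  rw [Nat.add_sub_cancel] at key hV1
  push_cast at key ⊢
  refine le_trans ?_ key
  -- Splitting off the first bids and the last report pairs the bids of round r + 1 with the reports
  -- of round r.
  rw [Finset.sum_range_succ', Finset.sum_range_succ (fun r => V r * |e r - e' r|)]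
  have h0 : (zeroDigits L (n * 0 + i) : ℝ) * g 0 ≤ 2 * zeroDigits L i := by
    rw [Nat.mul_zero, Nat.zero_add, mul_comm]
    gcongr
  have h1 : V R' * |e R' - e' R'| ≤ 1 := by
    rcases he R' with h | h <;> rcases he' R' with h' | h' <;> simp [h, h', hV1]
  have h2 : ∑ r ∈ Finset.range R', (zeroDigits L (n * (r + 1) + i) : ℝ) * g (r + 1) +
      ∑ r ∈ Finset.range R', V r * |e r - e' r| ≤ ∑ r ∈ Finset.range R',
      ((zeroDigits L (n * (r + 1) + i) : ℝ) + max (zeroDigits L (n * (r + 1) + i) : ℝ)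
        (zeroDigits L (n * r + i) : ℝ)) := by
    rw [← Finset.sum_add_distrib]
    refine Finset.sum_le_sum fun r hr => ?_
    have hr := Finset.mem_range.1 hr
    have hgr := mul_le_mul_of_nonneg_left (hg r (by omega))
      (Nat.cast_nonneg (α := ℝ) (zeroDigits L (n * (r + 1) + i)))
    have hVr := hV r
    have m1 := le_max_left (zeroDigits L (n * (r + 1) + i) : ℝ) (zeroDigits L (n * r + i))
    have m2 := le_max_right (zeroDigits L (n * (r + 1) + i) : ℝ) (zeroDigits L (n * r + i))
    have p1 := Nat.cast_nonneg (α := ℝ) (zeroDigits L (n * (r + 1) + i))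
    rcases he r with h | h <;> rcases he' r with h' | h' <;> rw [h, h'] at hgr ⊢ <;>
      norm_num at hgr ⊢ <;> linarith
  linarith

/-! ### Partial sums of the binary mechanism -/

/-- The exact partial sums of the counter are those of the stream `σ` at time `t`. -/
def CounterState.Tracks (c : CounterState) (σ : ℕ → ℝ) (t : ℕ) : Prop :=
  c.time = t ∧ ∀ j, c.a j = ∑ u ∈ Finset.range (2 ^ j * (t / 2 ^ j)), σ u -
    ∑ u ∈ Finset.range (2 ^ (j + 1) * (t / 2 ^ (j + 1))), σ u

theorem CounterState.tracks_init (σ : ℕ → ℝ) : CounterState.init.Tracks σ 0 := by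
  refine ⟨rfl, fun j => ?_⟩
  simp [CounterState.init]

theorem two_pow_mul_div_of_lt_padicValNat {t j : ℕ} (hj : j ≤ padicValNat 2 (t + 1)) :
    2 ^ j * ((t + 1) / 2 ^ j) = t + 1 :=
  Nat.mul_div_cancel' ((pow_dvd_pow 2 hj).trans pow_padicValNat_dvd)

theorem succ_div_two_pow_of_padicValNat_lt {t j : ℕ} (hj : padicValNat 2 (t + 1) < j) :
    (t + 1) / 2 ^ j = t / 2 ^ j := by
  rw [Nat.succ_div, if_neg, add_zero]
  intro h
  exact pow_succ_padicValNat_not_dvd (p := 2) (Nat.succ_ne_zero t) ((pow_dvd_pow 2 hj).trans h)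

theorem two_pow_padicValNat_mul_div (t : ℕ) :
    2 ^ padicValNat 2 (t + 1) * (t / 2 ^ padicValNat 2 (t + 1)) =
      t + 1 - 2 ^ padicValNat 2 (t + 1) := by
  have h := two_pow_mul_div_of_lt_padicValNat (le_refl (padicValNat 2 (t + 1)))
  rw [Nat.succ_div, if_pos pow_padicValNat_dvd, Nat.mul_succ] at h
  omega

theorem two_pow_succ_padicValNat_mul_div (t : ℕ) :
    2 ^ (padicValNat 2 (t + 1) + 1) * (t / 2 ^ (padicValNat 2 (t + 1) + 1)) =
      t + 1 - 2 ^ padicValNat 2 (t + 1) := by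
  obtain ⟨m, hm⟩ := exists_odd_eq_two_pow_padicValNat_mul (Nat.succ_ne_zero t)
  rw [Nat.succ_eq_add_one] at hm
  rw [← succ_div_two_pow_of_padicValNat_lt (Nat.lt_succ_self _)]
  generalize padicValNat 2 (t + 1) = i at *
  rw [hm, pow_succ, ← Nat.div_div_eq_div_mul, Nat.mul_div_cancel_left _ (by positivity),
    show (2 * m + 1) / 2 = m by omega, Nat.mul_add, mul_one, Nat.add_sub_cancel, mul_assoc]

/-- The prefix-sum differences telescope: the levels below i together cover the items since position
t + 1 - 2^i. -/
theorem CounterState.Tracks.sum_a_add {c : CounterState} {σ : ℕ → ℝ} {t : ℕ}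
    (h : c.Tracks σ t) : ∑ j ∈ Finset.range (padicValNat 2 (t + 1)), c.a j + σ t =
      ∑ u ∈ dyadicBlock (t + 1), σ u := by
  simp only [h.2]
  rw [Finset.sum_range_sub' (fun j => ∑ u ∈ Finset.range (2 ^ j * (t / 2 ^ j)), σ u),
    two_pow_padicValNat_mul_div, dyadicBlock, Finset.sum_Ico_eq_sub _ (Nat.sub_le _ _),
    Finset.sum_range_succ]
  simp
  ring

theorem CounterState.Tracks.feed {c : CounterState} {σ : ℕ → ℝ} {t : ℕ}
    (h : c.Tracks σ t) (ξ : ℝ) : (c.feed (σ t) ξ).Tracks σ (t + 1) := by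
  refine ⟨by simp [CounterState.feed, h.1], fun j => ?_⟩
  simp only [CounterState.feed, h.1]
  split_ifs with h1 h2
  · rw [two_pow_mul_div_of_lt_padicValNat h1.le, two_pow_mul_div_of_lt_padicValNat h1, sub_self]
  · subst h2
    rw [h.sum_a_add, two_pow_mul_div_of_lt_padicValNat le_rfl,
      succ_div_two_pow_of_padicValNat_lt (Nat.lt_succ_self _), two_pow_succ_padicValNat_mul_div,
      dyadicBlock, Finset.sum_Ico_eq_sub _ (Nat.sub_le _ _)]
  · rw [succ_div_two_pow_of_padicValNat_lt (by omega),
      succ_div_two_pow_of_padicValNat_lt (by omega), h.2]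

namespace PMatchParams

/-! ### Single turns -/

/-- The good on which bidder `i` with valuation `w` bids in her turn of round `r`, if any. -/
noncomputable def State.bidGood {q : PMatchParams} (S : q.State)
    (sel : ℕ → Fin q.n → UnitDemand q.k → (Fin q.k → ℝ) → Fin q.k) (r : ℕ) (i : Fin q.n)
    (w : UnitDemand q.k) : Option (Fin q.k) :=
  open scoped Classical in
  if S.μ i = .unmatched ∧ 0 < (w (sel r i w S.price) : ℝ) - S.price (sel r i w S.price) then
    some (sel r i w S.price)
  else none

/-- The item fed to the counter of good `j` in the turn of bidder `i`. -/
noncomputable def State.bidItem {q : PMatchParams} (S : q.State)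
    (sel : ℕ → Fin q.n → UnitDemand q.k → (Fin q.k → ℝ) → Fin q.k) (r : ℕ) (i : Fin q.n)
    (w : UnitDemand q.k) (j : Fin q.k) : ℝ :=
  open scoped Classical in
  if ¬S.halted ∧ S.bidGood sel r i w = some j then 1 else 0

/-- The item fed to `counter(0)` in the turn of bidder `i`. -/
noncomputable def State.reportItem {q : PMatchParams} (S : q.State) (i : Fin q.n) : ℝ :=
  open scoped Classical in
  if ¬S.halted ∧ S.Outbid i then 1 else 0

theorem State.propose_of_halted {q : PMatchParams} {S : q.State}
    (sel : ℕ → Fin q.n → UnitDemand q.k → (Fin q.k → ℝ) → Fin q.k)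
    (v : Fin q.n → UnitDemand q.k) (r : ℕ) (i : Fin q.n) (ξ : Fin q.k → ℝ) (h : S.halted) :
    S.propose sel v r i ξ = S := by
  rw [State.propose, if_pos h]

/-- Merges the branches of `propose` into one call of `bid`, so that measurability and comparison of
runs need no case split on the branch. -/
theorem State.propose_of_not_halted {q : PMatchParams} {S : q.State}
    (sel : ℕ → Fin q.n → UnitDemand q.k → (Fin q.k → ℝ) → Fin q.k)
    (v : Fin q.n → UnitDemand q.k) (r : ℕ) (i : Fin q.n) (ξ : Fin q.k → ℝ) (h : ¬S.halted) :
    open scoped Classical in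
    S.propose sel v r i ξ = State.bid
      { S with
        μ := if S.μ i = .unmatched then Function.update S.μ i
          (match S.bidGood sel r i (v i) with | some j => .good j | none => .dummy) else S.μ
        d := match S.bidGood sel r i (v i) with
          | some j => Function.update S.d i (S.counter j).reading
          | none => S.d }
      (S.bidItem sel r i (v i)) ξ := by
  classical
  rw [State.propose, if_neg h]
  have key : ∀ j, S.bidItem sel r i (v i) j = if S.bidGood sel r i (v i) = some j then 1 else 0 := by
    intro j; simp [State.bidItem, h]
  rcases hμ : S.μ i with _ | _ | j₀
  · by_cases hv : (v i (sel r i (v i) S.price) : ℝ) - S.price (sel r i (v i) S.price) ≤ 0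
    · have hb : S.bidGood sel r i (v i) = none := by simp [State.bidGood, sub_nonpos.1 hv]
      have hi : S.bidItem sel r i (v i) = 0 := by
        funext j; simp [key, hb]
      simp [hv, hb, hi]
    · have hb : S.bidGood sel r i (v i) = some (sel r i (v i) S.price) := by
        rw [State.bidGood, if_pos ⟨hμ, not_le.1 hv⟩]
      have hi : S.bidItem sel r i (v i) = Pi.single (sel r i (v i) S.price) 1 := by
        funext j
        simp [key, hb, Pi.single_apply, eq_comm]
      simp only [hv, hb, hi, if_true, if_false]
  all_goals
    have hb : S.bidGood sel r i (v i) = none := by simp [State.bidGood, hμ]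
    have hi : S.bidItem sel r i (v i) = 0 := by
      funext j; simp [key, hb]
    simp [hb, hi]

theorem State.report_of_halted {q : PMatchParams} {S : q.State} (i : Fin q.n) (ξ : ℝ)
    (h : S.halted) : S.report i ξ = S := by
  rw [State.report, if_pos h]

theorem State.report_of_not_halted {q : PMatchParams} {S : q.State} (i : Fin q.n) (ξ : ℝ)
    (h : ¬S.halted) :
    open scoped Classical in
    S.report i ξ =
      { S with
        μ := if S.Outbid i then Function.update S.μ i .unmatched else S.μ
        counter0 := S.counter0.feed (S.reportItem i) ξ } := by
  rw [State.report, if_neg h]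
  by_cases ho : S.Outbid i <;> simp [ho, h, State.reportItem]

/-! ### The run driven by noisy partial sums -/

/-- The partial sum created at time `s` is used by a reading of `counter(0)` at the end of
a round. -/
def UsedAtRoundEnd (n s : ℕ) : Prop := ∃ r, IsUsedAt s (n * r)

/-- The exact partial sum which the turn of bidder `i` creates in the counter of good `j`. -/
noncomputable def State.goodSum {q : PMatchParams} (S : q.State)
    (sel : ℕ → Fin q.n → UnitDemand q.k → (Fin q.k → ℝ) → Fin q.k) (r : ℕ) (i : Fin q.n)
    (w : UnitDemand q.k) (j : Fin q.k) : ℝ :=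
  open scoped Classical in
  -- After halting nothing is fed; the value 0 makes η equal to the noise there and costs no budget.
  if S.halted then 0 else
    ∑ l ∈ Finset.range (padicValNat 2 ((S.counter j).time + 1)), (S.counter j).a l +
      S.bidItem sel r i w j

/-- The exact partial sum which the report of bidder `i` creates in `counter(0)`; it is replaced
by `0` if no reading at the end of a round uses it. -/
noncomputable def State.reportSum {q : PMatchParams} (S : q.State) (i : Fin q.n) : ℝ :=
  open scoped Classical in
  -- Only round-end readings of counter(0) are tested or released, so the other sums can be exempted
  -- from the budget.
  if S.halted ∨ ¬UsedAtRoundEnd q.n (S.counter0.time + 1) then 0 else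
    ∑ l ∈ Finset.range (padicValNat 2 (S.counter0.time + 1)), S.counter0.a l + S.reportItem i

section Driven

variable (q : PMatchParams) (sel : ℕ → Fin q.n → UnitDemand q.k → (Fin q.k → ℝ) → Fin q.k)
  (v : Fin q.n → UnitDemand q.k) (η : q.Noise)

/-- `afterProposals`, where `η` prescribes the noisy partial sums instead of the noise. -/
noncomputable def drivenProposals (r : Fin q.rounds) (S : q.State) : ℕ → q.State
  | 0 => S
  | l + 1 =>
    if h : l < q.n then
      (drivenProposals r S l).propose sel v r ⟨l, h⟩ (fun j => η (some j, r, ⟨l, h⟩) -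
        (drivenProposals r S l).goodSum sel r ⟨l, h⟩ (v ⟨l, h⟩) j)
    else drivenProposals r S l

/-- `afterReports`, where `η` prescribes the noisy partial sums instead of the noise. -/
noncomputable def drivenReports (r : Fin q.rounds) (S : q.State) : ℕ → q.State
  | 0 => S
  | l + 1 =>
    if h : l < q.n then
      (drivenReports r S l).report ⟨l, h⟩ (η (none, r, ⟨l, h⟩) -
        (drivenReports r S l).reportSum ⟨l, h⟩)
    else drivenReports r S l

/-- `afterRounds`, where `η` prescribes the noisy partial sums instead of the noise. -/
noncomputable def drivenRounds : ℕ → q.State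
  | 0 => State.init q
  | r + 1 =>
    if h : r < q.rounds then
      q.haltTest (drivenRounds r) (q.drivenReports η ⟨r, h⟩
        (q.drivenProposals sel v η ⟨r, h⟩ (drivenRounds r) q.n) q.n)
    else drivenRounds r

/-- The state of the driven run after `l` proposals in round `r`. -/
noncomputable def proposeState (r : Fin q.rounds) (l : ℕ) : q.State :=
  q.drivenProposals sel v η r (q.drivenRounds sel v η r) l

/-- The state of the driven run after `l` reports in round `r`. -/
noncomputable def reportState (r : Fin q.rounds) (l : ℕ) : q.State :=
  q.drivenReports η r (q.proposeState sel v η r q.n) l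

/-- The exact partial sums along the driven run. -/
noncomputable def drivenSums : q.Noise
  | (some j, r, i) => (q.proposeState sel v η r i).goodSum sel r i (v i) j
  | (none, r, i) => (q.reportState sel v η r i).reportSum i

/-- What the driven run releases. -/
noncomputable def drivenReleased : (Fin q.rounds → Fin q.n → Fin q.k → ℝ) × (Fin q.rounds → ℝ) :=
  (fun r i => (q.proposeState sel v η r (i + 1)).price,
   fun r => (q.drivenRounds sel v η (r + 1)).counter0.reading)

/-- The exact partial sums along the run with noise `ω`. -/
noncomputable def exactSums (ω : q.Noise) : q.Noise
  | (some j, r, i) =>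
    (q.afterProposals sel v ω r (q.afterRounds sel v ω r) i).goodSum sel r i (v i) j
  | (none, r, i) => (q.afterReports ω r
      (q.afterProposals sel v ω r (q.afterRounds sel v ω r) q.n) i).reportSum i

variable {q sel v η}

/-- The noises need to match only at turns where the states already agree. This breaks the
circularity, since each correction is a function of the state before its turn. -/
theorem drivenRounds_eq_of_forall {ω : q.Noise} {R : ℕ}
    (hP : ∀ r : Fin q.rounds, r < R → q.drivenRounds sel v η r = q.afterRounds sel v ω r →
      ∀ l : Fin q.n, q.proposeState sel v η r l =
        q.afterProposals sel v ω r (q.afterRounds sel v ω r) l →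
      ∀ j, η (some j, r, l) - (q.proposeState sel v η r l).goodSum sel r l (v l) j =
        ω (some j, r, l))
    (hR : ∀ r : Fin q.rounds, r < R → ∀ l : Fin q.n, q.reportState sel v η r l =
        q.afterReports ω r (q.afterProposals sel v ω r (q.afterRounds sel v ω r) q.n) l →
      η (none, r, l) - (q.reportState sel v η r l).reportSum l = ω (none, r, l)) :
    q.drivenRounds sel v η R = q.afterRounds sel v ω R ∧
    ∀ r : Fin q.rounds, r < R →
      (∀ l ≤ q.n, q.proposeState sel v η r l =
        q.afterProposals sel v ω r (q.afterRounds sel v ω r) l) ∧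
      ∀ l ≤ q.n, q.reportState sel v η r l =
        q.afterReports ω r (q.afterProposals sel v ω r (q.afterRounds sel v ω r) q.n) l := by
  induction R with
  | zero => exact ⟨rfl, fun r hr => absurd hr (Nat.not_lt_zero _)⟩
  | succ R ih =>
    obtain ⟨ih1, ih2⟩ := ih (fun r hr => hP r (by omega)) (fun r hr => hR r (by omega))
    by_cases h : R < q.rounds
    · have h1 : ∀ l ≤ q.n, q.proposeState sel v η ⟨R, h⟩ l =
          q.afterProposals sel v ω ⟨R, h⟩ (q.afterRounds sel v ω R) l := by
        intro l
        induction l with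
        | zero => intro _; exact ih1
        | succ l ihl =>
          intro hl
          have hl' : l < q.n := by omega
          have e := hP ⟨R, h⟩ (Nat.lt_succ_self R) ih1 ⟨l, hl'⟩ (ihl hl'.le)
          have e0 := ihl hl'.le
          unfold proposeState at e e0 ⊢
          rw [drivenProposals, afterProposals, dif_pos hl', dif_pos hl', funext e, e0]
      have h2 : ∀ l ≤ q.n, q.reportState sel v η ⟨R, h⟩ l = q.afterReports ω ⟨R, h⟩
          (q.afterProposals sel v ω ⟨R, h⟩ (q.afterRounds sel v ω R) q.n) l := by
        intro l
        induction l with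
        | zero => intro _; exact h1 q.n le_rfl
        | succ l ihl =>
          intro hl
          have hl' : l < q.n := by omega
          have e := hR ⟨R, h⟩ (Nat.lt_succ_self R) ⟨l, hl'⟩ (ihl hl'.le)
          have e0 := ihl hl'.le
          unfold reportState at e e0 ⊢
          rw [drivenReports, afterReports, dif_pos hl', dif_pos hl', e, e0]
      refine ⟨?_, fun r hr => ?_⟩
      · have e2 := h2 q.n le_rfl
        unfold reportState proposeState at e2
        rw [drivenRounds, afterRounds, dif_pos h, dif_pos h, round, ← e2, ih1]
      · rcases Nat.lt_succ_iff_lt_or_eq.1 hr with hr | hr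
        · exact ih2 r hr
        · obtain ⟨r, hr'⟩ := r
          obtain rfl : r = R := hr
          exact ⟨h1, h2⟩
    · refine ⟨?_, fun r hr => ih2 r (by have := r.2; omega)⟩
      rw [drivenRounds, afterRounds, dif_neg h, dif_neg h, ih1]

/-- The first alternative gives injectivity of η ↦ η - B(η) and the transfer of the output, the
second gives surjectivity. -/
theorem drivenSums_eq_and_released_eq {ω : q.Noise}
    (h : η = ω + q.drivenSums sel v η ∨ η = ω + q.exactSums sel v ω) :
    q.drivenSums sel v η = q.exactSums sel v ω ∧
      q.drivenReleased sel v η = q.released sel v ω := by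
  have key := fun R => drivenRounds_eq_of_forall (sel := sel) (v := v) (η := η) (ω := ω) (R := R)
    (fun r _ _ l e j => by
      rcases h with h | h
      · nth_rw 1 [h]; simp [drivenSums]
      · rw [e, h]; simp [exactSums])
    (fun r _ l e => by
      rcases h with h | h
      · nth_rw 1 [h]; simp [drivenSums]
      · rw [e, h]; simp [exactSums])
  constructor
  · funext c
    obtain ⟨_ | j, r, i⟩ := c
    · simp only [drivenSums, exactSums, ((key q.rounds).2 r r.2).2 i i.2.le]
    · simp only [drivenSums, exactSums, ((key q.rounds).2 r r.2).1 i i.2.le]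
  · refine Prod.ext ?_ ?_
    · funext r i
      simp only [drivenReleased, released, ((key q.rounds).2 r r.2).1 (i + 1) i.2]
    · funext r
      simp only [drivenReleased, released, (key _).1]

theorem sub_drivenSums_injective : Function.Injective fun η => η - q.drivenSums sel v η := by
  intro η η' h
  have h1 := (drivenSums_eq_and_released_eq (sel := sel) (v := v) (η := η)
    (ω := η - q.drivenSums sel v η) (Or.inl (by simp))).1
  have h2 := (drivenSums_eq_and_released_eq (sel := sel) (v := v) (η := η')
    (ω := η' - q.drivenSums sel v η') (Or.inl (by simp))).1
  simp only at h
  rw [← h, ← h1] at h2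
  rw [h2] at h
  exact sub_left_injective h

theorem sub_drivenSums_surjective : Function.Surjective fun η => η - q.drivenSums sel v η := by
  intro ω
  refine ⟨ω + q.exactSums sel v ω, ?_⟩
  simp only [(drivenSums_eq_and_released_eq (sel := sel) (v := v)
    (η := ω + q.exactSums sel v ω) (ω := ω) (Or.inr rfl)).1, add_sub_cancel_right]

theorem released_sub_drivenSums :
    q.released sel v (η - q.drivenSums sel v η) = q.drivenReleased sel v η :=
  (drivenSums_eq_and_released_eq (Or.inl (by simp))).2.symm

end Driven

end PMatchParams

/-! ### Measurability of the driven run, with discrete components treated through their fibres. -/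

/-- All fibres of `D` are measurable sets. -/
def HasMeasurableFibers {Ω Δ : Type*} [MeasurableSpace Ω] (D : Ω → Δ) : Prop :=
  ∀ x, MeasurableSet (D ⁻¹' {x})

namespace HasMeasurableFibers

variable {Ω Δ E : Type*} [MeasurableSpace Ω] {D : Ω → Δ}

theorem measurableSet_preimage [Countable Δ] (h : HasMeasurableFibers D) (s : Set Δ) :
    MeasurableSet (D ⁻¹' s) := by
  rw [← Set.biUnion_preimage_singleton]
  exact MeasurableSet.biUnion s.to_countable fun x _ => h x

theorem comp [Countable Δ] (h : HasMeasurableFibers D) (g : Δ → E) :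
    HasMeasurableFibers fun ω => g (D ω) :=
  fun x => h.measurableSet_preimage (g ⁻¹' {x})

theorem prodMk (h : HasMeasurableFibers D) {D' : Ω → E} (h' : HasMeasurableFibers D') :
    HasMeasurableFibers fun ω => (D ω, D' ω) := by
  rintro ⟨x, y⟩
  convert (h x).inter (h' y) using 1
  ext ω; simp

theorem pi {ι : Type*} [Countable ι] {G : ι → Ω → Δ} (h : ∀ i, HasMeasurableFibers (G i)) :
    HasMeasurableFibers fun ω i => G i ω := by
  intro x
  convert MeasurableSet.iInter fun i => h i (x i) using 1
  ext ω; simp [funext_iff]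

theorem of_measurableSet {p : Ω → Prop} (h : MeasurableSet {ω | p ω}) : HasMeasurableFibers p := by
  intro x
  by_cases hx : x
  · convert h using 1; ext ω; simp [hx]
  · convert h.compl using 1; ext ω; simp [hx]

theorem measurable_apply [Countable Δ] {α : Type*} [MeasurableSpace α]
    (h : HasMeasurableFibers D) {F : Δ → Ω → α} (hF : ∀ x, Measurable (F x)) :
    Measurable fun ω => F (D ω) ω := by
  intro s hs
  convert MeasurableSet.iUnion fun x => (h x).inter (hF x hs) using 1
  ext ω; simp

theorem measurable [Countable Δ] {α : Type*} [MeasurableSpace α] (h : HasMeasurableFibers D)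
    (F : Δ → α) : Measurable fun ω => F (D ω) :=
  h.measurable_apply (F := fun x _ => F x) fun _ => measurable_const

theorem ite {p : Ω → Prop} [DecidablePred p] (hp : MeasurableSet {ω | p ω})
    (h : HasMeasurableFibers D) {D' : Ω → Δ} (h' : HasMeasurableFibers D') :
    HasMeasurableFibers fun ω => if p ω then D ω else D' ω := by
  intro x
  convert (hp.inter (h x)).union (hp.compl.inter (h' x)) using 1
  ext ω
  by_cases hω : p ω <;> simp [hω]

end HasMeasurableFibers

/-- A randomly evolving counter all of whose components are measurable. -/
structure MeasurableCounter {Ω : Type*} [MeasurableSpace Ω] (c : Ω → CounterState) : Prop where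
  time : HasMeasurableFibers fun ω => (c ω).time
  a : ∀ l, Measurable fun ω => (c ω).a l
  ahat : ∀ l, Measurable fun ω => (c ω).ahat l

namespace MeasurableCounter

variable {Ω : Type*} [MeasurableSpace Ω] {c : Ω → CounterState}

theorem reading (h : MeasurableCounter c) : Measurable fun ω => (c ω).reading :=
  h.time.measurable_apply (F := fun t ω =>
    ∑ j ∈ (Finset.range t.size).filter (fun j => t.testBit j = true), (c ω).ahat j)
    fun _ => Finset.measurable_sum _ fun j _ => h.ahat j

theorem sum_a (h : MeasurableCounter c) :
    Measurable fun ω => ∑ l ∈ Finset.range (padicValNat 2 ((c ω).time + 1)), (c ω).a l :=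
  h.time.measurable_apply (F := fun t ω =>
    ∑ l ∈ Finset.range (padicValNat 2 (t + 1)), (c ω).a l)
    fun _ => Finset.measurable_sum _ fun j _ => h.a j

theorem feed (h : MeasurableCounter c) {σ ξ : Ω → ℝ} (hσ : Measurable σ) (hξ : Measurable ξ) :
    MeasurableCounter fun ω => (c ω).feed (σ ω) (ξ ω) := by
  have hs := h.sum_a
  refine ⟨h.time.comp (· + 1), fun l => ?_, fun l => ?_⟩
  · refine h.time.measurable_apply (F := fun t ω => if l < padicValNat 2 (t + 1) then 0 else
      if l = padicValNat 2 (t + 1) then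
        ∑ l ∈ Finset.range (padicValNat 2 ((c ω).time + 1)), (c ω).a l + σ ω
      else (c ω).a l) fun t => ?_
    have := h.a l
    split_ifs <;> fun_prop
  · refine h.time.measurable_apply (F := fun t ω => if l < padicValNat 2 (t + 1) then 0 else
      if l = padicValNat 2 (t + 1) then
        ∑ l ∈ Finset.range (padicValNat 2 ((c ω).time + 1)), (c ω).a l + σ ω + ξ ω
      else (c ω).ahat l) fun t => ?_
    have := h.ahat l
    split_ifs <;> fun_prop

theorem ite {p : Ω → Prop} [DecidablePred p] (hp : MeasurableSet {ω | p ω})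
    (h : MeasurableCounter c) {c' : Ω → CounterState} (h' : MeasurableCounter c') :
    MeasurableCounter fun ω => if p ω then c ω else c' ω := by
  refine ⟨?_, fun l => ?_, fun l => ?_⟩
  · simp only [apply_ite CounterState.time]
    exact h.time.ite hp h'.time
  · simp only [apply_ite CounterState.a, ite_apply]
    exact (h.a l).ite hp (h'.a l)
  · simp only [apply_ite CounterState.ahat, ite_apply]
    exact (h.ahat l).ite hp (h'.ahat l)

end MeasurableCounter

instance Assignment.countable (k : ℕ) : Countable (Assignment k) := by
  refine Function.Injective.countable (β := Option (Option (Fin k)))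
    (f := fun a => match a with
      | .unmatched => none
      | .dummy => some none
      | .good j => some (some j)) ?_
  rintro (_ | _ | _) (_ | _ | _) h <;> simp_all

namespace PMatchParams

/-- A randomly evolving state of `PMatch` all of whose components are measurable. -/
structure MeasurableState {q : PMatchParams} {Ω : Type*} [MeasurableSpace Ω] (f : Ω → q.State) :
    Prop where
  μ : HasMeasurableFibers fun ω => (f ω).μ
  d : ∀ i, Measurable fun ω => (f ω).d i
  level : HasMeasurableFibers fun ω => (f ω).level
  counter : ∀ j, MeasurableCounter fun ω => (f ω).counter j
  counter0 : MeasurableCounter fun ω => (f ω).counter0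
  halted : MeasurableSet {ω | (f ω).halted}

namespace MeasurableState

variable {q : PMatchParams} {Ω : Type*} [MeasurableSpace Ω] {f : Ω → q.State}
  {sel : ℕ → Fin q.n → UnitDemand q.k → (Fin q.k → ℝ) → Fin q.k} {v : Fin q.n → UnitDemand q.k}

theorem init : MeasurableState fun _ : Ω => State.init q :=
  have h : MeasurableCounter fun _ : Ω => CounterState.init :=
    ⟨fun _ => .const _, fun _ => measurable_const, fun _ => measurable_const⟩
  ⟨fun _ => .const _, fun _ => measurable_const, fun _ => .const _, fun _ => h, h, .const _⟩

theorem ite {p : Ω → Prop} [DecidablePred p] (hp : MeasurableSet {ω | p ω})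
    (h : MeasurableState f) {f' : Ω → q.State} (h' : MeasurableState f') :
    MeasurableState fun ω => if p ω then f ω else f' ω := by
  refine ⟨?_, fun i => ?_, ?_, fun j => ?_, ?_, ?_⟩
  · simp only [apply_ite State.μ]
    exact h.μ.ite hp h'.μ
  · simp only [apply_ite State.d, ite_apply]
    exact (h.d i).ite hp (h'.d i)
  · simp only [apply_ite State.level]
    exact h.level.ite hp h'.level
  · simp only [apply_ite State.counter, ite_apply]
    exact (h.counter j).ite hp (h'.counter j)
  · simp only [apply_ite State.counter0]
    exact h.counter0.ite hp h'.counter0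
  · convert (hp.inter h.halted).union (hp.compl.inter h'.halted) using 1
    ext ω
    by_cases hω : p ω <;> simp [hω]

/-- The bid depends on the random coins only through `μ` and the price levels, which take countably
many values; so `sel` needs no measurability. -/
theorem bidGood (h : MeasurableState f) (r : ℕ) (i : Fin q.n) (w : UnitDemand q.k) :
    HasMeasurableFibers fun ω => (f ω).bidGood sel r i w := by
  classical
  exact (h.μ.prodMk h.level).comp fun x =>
    if x.1 i = .unmatched ∧ 0 < (w (sel r i w fun j => q.α * x.2 j) : ℝ) -
        q.α * x.2 (sel r i w fun j => q.α * x.2 j) then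
      some (sel r i w fun j => q.α * x.2 j)
    else none

theorem bidItem (h : MeasurableState f) (r : ℕ) (i : Fin q.n) (w : UnitDemand q.k) (j : Fin q.k) :
    Measurable fun ω => (f ω).bidItem sel r i w j := by
  classical
  exact ((HasMeasurableFibers.of_measurableSet h.halted).prodMk
    (h.bidGood (sel := sel) r i w)).measurable fun x => if ¬x.1 ∧ x.2 = some j then (1 : ℝ) else 0

theorem outbid (h : MeasurableState f) (i : Fin q.n) : MeasurableSet {ω | (f ω).Outbid i} := by
  simp only [State.Outbid, Set.ofPred_exists]
  refine MeasurableSet.iUnion fun j => ?_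
  refine MeasurableSet.inter ?_ ?_
  · exact h.μ.measurableSet_preimage {μ | μ i = .good j}
  · exact measurableSet_le measurable_const ((h.counter j).reading.sub (h.d i))

theorem reportItem (h : MeasurableState f) (i : Fin q.n) :
    Measurable fun ω => (f ω).reportItem i := by
  classical
  exact Measurable.ite (h.halted.compl.inter (h.outbid i)) measurable_const measurable_const

theorem goodSum (h : MeasurableState f) (r : ℕ) (i : Fin q.n) (w : UnitDemand q.k) (j : Fin q.k) :
    Measurable fun ω => (f ω).goodSum sel r i w j := by
  classical
  exact Measurable.ite h.halted measurable_const
    ((h.counter j).sum_a.add (h.bidItem r i w j))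

theorem reportSum (h : MeasurableState f) (i : Fin q.n) :
    Measurable fun ω => (f ω).reportSum i := by
  classical
  exact Measurable.ite (h.halted.union (h.counter0.time.measurableSet_preimage
    {t | ¬UsedAtRoundEnd q.n (t + 1)})) measurable_const
    (h.counter0.sum_a.add (h.reportItem i))

theorem bid (h : MeasurableState f) {b ξ : Ω → Fin q.k → ℝ} (hb : ∀ j, Measurable fun ω => b ω j)
    (hξ : ∀ j, Measurable fun ω => ξ ω j) : MeasurableState fun ω => (f ω).bid (b ω) (ξ ω) := by
  classical
  have hc : ∀ j, MeasurableCounter fun ω => ((f ω).counter j).feed (b ω j) (ξ ω j) :=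
    fun j => (h.counter j).feed (hb j) (hξ j)
  refine ⟨h.μ, h.d, ?_, hc, h.counter0, h.halted⟩
  refine HasMeasurableFibers.pi fun j => ?_
  have hl : HasMeasurableFibers fun ω => (f ω).level j := h.level.comp fun l => l j
  exact HasMeasurableFibers.ite (measurableSet_le (hl.measurable fun l : ℕ =>
    ((l : ℝ) + 1) * (q.s - q.m)) (hc j).reading) (hl.comp (· + 1)) hl

theorem propose (h : MeasurableState f) (r : ℕ) (i : Fin q.n) {ξ : Ω → Fin q.k → ℝ}
    (hξ : ∀ j, Measurable fun ω => ξ ω j) :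
    MeasurableState fun ω => (f ω).propose sel v r i (ξ ω) := by
  classical
  have hg := h.bidGood (sel := sel) r i (v i)
  have key : MeasurableState fun ω => State.bid
      { f ω with
        μ := if (f ω).μ i = .unmatched then Function.update (f ω).μ i
          (match (f ω).bidGood sel r i (v i) with | some j => .good j | none => .dummy)
          else (f ω).μ
        d := match (f ω).bidGood sel r i (v i) with
          | some j => Function.update (f ω).d i ((f ω).counter j).reading
          | none => (f ω).d }
      ((f ω).bidItem sel r i (v i)) (ξ ω) := by
    refine MeasurableState.bid (f := fun ω => ({ f ω with
        μ := if (f ω).μ i = .unmatched then Function.update (f ω).μ i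
          (match (f ω).bidGood sel r i (v i) with | some j => .good j | none => .dummy)
          else (f ω).μ
        d := match (f ω).bidGood sel r i (v i) with
          | some j => Function.update (f ω).d i ((f ω).counter j).reading
          | none => (f ω).d } : q.State))
      ⟨?_, fun i' => ?_, h.level, h.counter, h.counter0, h.halted⟩ (h.bidItem r i (v i)) hξ
    · exact (h.μ.prodMk hg).comp fun x => if x.1 i = .unmatched then Function.update x.1 i
          (match x.2 with | some j => .good j | none => .dummy) else x.1
    · refine hg.measurable_apply (F := fun x ω => (match x with
          | some j => Function.update (f ω).d i ((f ω).counter j).reading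
          | none => (f ω).d) i') fun x => ?_
      rcases x with _ | j
      · exact h.d i'
      · by_cases e : i' = i
        · subst e; simpa using (h.counter j).reading
        · simpa [e] using h.d i'
  convert h.ite h.halted key using 2 with ω
  by_cases hω : (f ω).halted
  · rw [if_pos hω, State.propose_of_halted _ _ _ _ _ hω]
  · rw [if_neg hω]
    exact State.propose_of_not_halted _ _ _ _ _ hω

theorem report (h : MeasurableState f) (i : Fin q.n) {ξ : Ω → ℝ} (hξ : Measurable ξ) :
    MeasurableState fun ω => (f ω).report i (ξ ω) := by
  classical
  have key : MeasurableState fun ω => ({ f ω with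
        μ := if (f ω).Outbid i then Function.update (f ω).μ i .unmatched else (f ω).μ
        counter0 := (f ω).counter0.feed ((f ω).reportItem i) (ξ ω) } : q.State) :=
    ⟨HasMeasurableFibers.ite (h.outbid i) (h.μ.comp fun μ => Function.update μ i .unmatched) h.μ,
      h.d, h.level, h.counter, h.counter0.feed (h.reportItem i) hξ, h.halted⟩
  convert h.ite h.halted key using 2 with ω
  by_cases hω : (f ω).halted
  · rw [if_pos hω, State.report_of_halted _ _ hω]
  · rw [if_neg hω, State.report_of_not_halted _ _ hω]

theorem haltTest (h : MeasurableState f) {f' : Ω → q.State} (h' : MeasurableState f') :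
    MeasurableState fun ω => q.haltTest (f ω) (f' ω) := by
  classical
  refine MeasurableState.ite h'.halted h' (MeasurableState.ite
    (measurableSet_lt (h'.counter0.reading.sub h.counter0.reading) measurable_const) ?_ h')
  exact ⟨h'.μ.comp fun μ i => match (motive := Assignment q.k → Assignment q.k) μ i with
      | .unmatched => .dummy
      | x => x, h'.d, h'.level, h'.counter, h'.counter0, .const _⟩

theorem drivenProposals (r : Fin q.rounds) {f : q.Noise → q.State} (h : MeasurableState f) (l : ℕ) :
    MeasurableState fun η => q.drivenProposals sel v η r (f η) l := by
  induction l with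
  | zero => exact h
  | succ l ih =>
    by_cases hl : l < q.n
    · simp only [PMatchParams.drivenProposals, dif_pos hl]
      exact ih.propose r ⟨l, hl⟩ fun j => (measurable_pi_apply _).sub (ih.goodSum r _ _ j)
    · simpa only [PMatchParams.drivenProposals, dif_neg hl] using ih

theorem drivenReports (r : Fin q.rounds) {f : q.Noise → q.State} (h : MeasurableState f) (l : ℕ) :
    MeasurableState fun η => q.drivenReports η r (f η) l := by
  induction l with
  | zero => exact h
  | succ l ih =>
    by_cases hl : l < q.n
    · simp only [PMatchParams.drivenReports, dif_pos hl]
      exact ih.report ⟨l, hl⟩ ((measurable_pi_apply _).sub (ih.reportSum _))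
    · simpa only [PMatchParams.drivenReports, dif_neg hl] using ih

theorem drivenRounds (r : ℕ) : MeasurableState fun η => q.drivenRounds sel v η r := by
  induction r with
  | zero => exact init
  | succ r ih =>
    by_cases hr : r < q.rounds
    · simp only [PMatchParams.drivenRounds, dif_pos hr]
      exact ih.haltTest ((ih.drivenProposals _ _).drivenReports _ _)
    · simpa only [PMatchParams.drivenRounds, dif_neg hr] using ih

theorem proposeState (r : Fin q.rounds) (l : ℕ) :
    MeasurableState fun η => q.proposeState sel v η r l :=
  (drivenRounds r).drivenProposals r l

theorem reportState (r : Fin q.rounds) (l : ℕ) :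
    MeasurableState fun η => q.reportState sel v η r l :=
  (proposeState r q.n).drivenReports r l

end MeasurableState

theorem measurable_drivenSums {q : PMatchParams}
    (sel : ℕ → Fin q.n → UnitDemand q.k → (Fin q.k → ℝ) → Fin q.k)
    (v : Fin q.n → UnitDemand q.k) : Measurable (q.drivenSums sel v) := by
  refine measurable_pi_lambda _ fun c => ?_
  obtain ⟨_ | j, r, i⟩ := c
  · exact (MeasurableState.reportState r i).reportSum i
  · exact (MeasurableState.proposeState r i).goodSum r i _ j

theorem measurable_drivenReleased {q : PMatchParams}
    (sel : ℕ → Fin q.n → UnitDemand q.k → (Fin q.k → ℝ) → Fin q.k)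
    (v : Fin q.n → UnitDemand q.k) : Measurable (q.drivenReleased sel v) := by
  refine Measurable.prodMk ?_ ?_
  · refine measurable_pi_lambda _ fun r => measurable_pi_lambda _ fun i =>
      measurable_pi_lambda _ fun j => ?_
    exact (MeasurableState.proposeState r (i + 1)).level.measurable fun l => q.α * l j
  · exact measurable_pi_lambda _ fun r => (MeasurableState.drivenRounds _).counter0.reading

end PMatchParams

/-! ### Public content of counters and states. -/

namespace CounterState

/-- Two counters with the same public content. -/
def Agree (c c' : CounterState) : Prop := c.time = c'.time ∧ c.ahat = c'.ahat

theorem Agree.reading_eq {c c' : CounterState} (h : c.Agree c') : c.reading = c'.reading := by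
  rw [reading, reading, h.1, h.2]

theorem feed_sub_ahat (c : CounterState) (σ ξ : ℝ) (l : ℕ) :
    (c.feed σ (ξ - (∑ j ∈ Finset.range (padicValNat 2 (c.time + 1)), c.a j + σ))).ahat l =
      if l < padicValNat 2 (c.time + 1) then 0 else
        if l = padicValNat 2 (c.time + 1) then ξ else c.ahat l := by
  simp [feed]

/-- With noise ξ minus the exact sum, the counter stores ξ itself, so the private items leave no
trace in the public part. -/
theorem Agree.feed_sub {c c' : CounterState} (h : c.Agree c') (σ σ' ξ : ℝ) :
    (c.feed σ (ξ - (∑ j ∈ Finset.range (padicValNat 2 (c.time + 1)), c.a j + σ))).Agree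
      (c'.feed σ' (ξ - (∑ j ∈ Finset.range (padicValNat 2 (c'.time + 1)), c'.a j + σ'))) := by
  refine ⟨by simp [feed, h.1], funext fun l => ?_⟩
  rw [feed_sub_ahat, feed_sub_ahat, h.1, h.2]

end CounterState

/-- At a nonzero digit l, 2^l (t / 2^l) is an odd multiple of 2^l, and the next multiple of 2^l
exceeds t. -/
theorem isUsedAt_of_testBit {t l : ℕ} (h : t.testBit l = true) :
    IsUsedAt (2 ^ l * (t / 2 ^ l)) t := by
  rw [Nat.testBit_eq_decide_div_mod_eq, decide_eq_true_eq] at h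
  have h2 : ¬2 ∣ t / 2 ^ l := by omega
  have hv : padicValNat 2 (2 ^ l * (t / 2 ^ l)) = l := by
    rw [padicValNat.mul (by positivity) (by rintro h0; simp [h0] at h2), padicValNat.prime_pow,
      padicValNat.eq_zero_of_not_dvd h2, add_zero]
  refine ⟨Nat.mul_div_le _ _, ?_⟩
  rw [hv]
  have := Nat.lt_mul_div_succ t (show 0 < 2 ^ l by positivity)
  rwa [Nat.mul_succ] at this

namespace PMatchParams

section Turns

variable {q : PMatchParams} {S : q.State}
  {sel : ℕ → Fin q.n → UnitDemand q.k → (Fin q.k → ℝ) → Fin q.k}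
  {v : Fin q.n → UnitDemand q.k} {r : ℕ} {i : Fin q.n} {ξ : Fin q.k → ℝ}

theorem State.propose_halted : (S.propose sel v r i ξ).halted = S.halted := by
  by_cases h : S.halted
  · rw [State.propose_of_halted _ _ _ _ _ h]
  · rw [State.propose_of_not_halted _ _ _ _ _ h]; rfl

theorem State.propose_counter0 : (S.propose sel v r i ξ).counter0 = S.counter0 := by
  by_cases h : S.halted
  · rw [State.propose_of_halted _ _ _ _ _ h]
  · rw [State.propose_of_not_halted _ _ _ _ _ h]; rfl

theorem State.propose_counter (h : ¬S.halted) (j : Fin q.k) : (S.propose sel v r i ξ).counter j =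
    (S.counter j).feed (S.bidItem sel r i (v i) j) (ξ j) := by
  rw [State.propose_of_not_halted _ _ _ _ _ h]; rfl

theorem State.propose_level (h : ¬S.halted) (j : Fin q.k) :
    open scoped Classical in
    (S.propose sel v r i ξ).level j =
      if ((S.level j : ℝ) + 1) * (q.s - q.m) ≤ ((S.propose sel v r i ξ).counter j).reading
      then S.level j + 1 else S.level j := by
  rw [State.propose_of_not_halted _ _ _ _ _ h]; rfl

theorem State.propose_μ_of_ne {i' : Fin q.n} (hi : i' ≠ i) :
    (S.propose sel v r i ξ).μ i' = S.μ i' := by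
  by_cases h : S.halted
  · rw [State.propose_of_halted _ _ _ _ _ h]
  · rw [State.propose_of_not_halted _ _ _ _ _ h]
    simp only [State.bid]
    split_ifs <;> simp [hi]

theorem State.propose_d_of_ne {i' : Fin q.n} (hi : i' ≠ i) :
    (S.propose sel v r i ξ).d i' = S.d i' := by
  by_cases h : S.halted
  · rw [State.propose_of_halted _ _ _ _ _ h]
  · rw [State.propose_of_not_halted _ _ _ _ _ h]
    simp only [State.bid]
    rcases S.bidGood sel r i (v i) with _ | j <;> simp [hi]

theorem State.propose_μ_self (h : ¬S.halted) :
    open scoped Classical in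
    (S.propose sel v r i ξ).μ i = if S.μ i = .unmatched then
      (match S.bidGood sel r i (v i) with | some j => .good j | none => .dummy) else S.μ i := by
  rw [State.propose_of_not_halted _ _ _ _ _ h]
  simp only [State.bid]
  rcases S.bidGood sel r i (v i) with _ | j <;> split_ifs <;> simp

theorem State.propose_d_self (h : ¬S.halted) :
    (S.propose sel v r i ξ).d i = match S.bidGood sel r i (v i) with
      | some j => (S.counter j).reading
      | none => S.d i := by
  rw [State.propose_of_not_halted _ _ _ _ _ h]
  simp only [State.bid]
  rcases S.bidGood sel r i (v i) with _ | j <;> simp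

theorem State.propose_μ_self_ne_unmatched (h : ¬S.halted) :
    (S.propose sel v r i ξ).μ i ≠ .unmatched := by
  rw [State.propose_μ_self h]
  split_ifs with h1
  · split <;> simp
  · exact h1

theorem State.bidItem_eq_zero_or_one (w : UnitDemand q.k) (j : Fin q.k) :
    S.bidItem sel r i w j = 0 ∨ S.bidItem sel r i w j = 1 := by
  unfold State.bidItem; split_ifs <;> simp

theorem State.sum_bidItem_le_one (w : UnitDemand q.k) : ∑ j, S.bidItem sel r i w j ≤ 1 := by
  classical
  unfold State.bidItem
  by_cases h : S.halted
  · simp [h]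
  · rcases S.bidGood sel r i w with _ | j₀
    · simp
    · simp [h]

theorem State.bidItem_eq_zero (w : UnitDemand q.k) (j : Fin q.k)
    (h : ¬S.halted → S.μ i ≠ .unmatched) : S.bidItem sel r i w j = 0 := by
  unfold State.bidItem
  refine if_neg fun ⟨h1, h2⟩ => ?_
  rw [State.bidGood, if_neg fun h3 => h h1 h3.1] at h2
  cases h2

theorem State.bidItem_congr {S' : q.State} {w : UnitDemand q.k} (hh : S.halted ↔ S'.halted)
    (hl : S.level = S'.level) (hμ : S.μ i = S'.μ i) :
    S.bidItem sel r i w = S'.bidItem sel r i w ∧ S.bidGood sel r i w = S'.bidGood sel r i w := by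
  have hp : S.price = S'.price := by funext j; simp only [State.price, hl]
  have hg : S.bidGood sel r i w = S'.bidGood sel r i w := by
    rw [State.bidGood, State.bidGood, hμ, hp]
  refine ⟨?_, hg⟩
  funext j
  rw [State.bidItem, State.bidItem, hg, propext hh]

variable {ξ : ℝ}

theorem State.report_halted : (S.report i ξ).halted = S.halted := by
  by_cases h : S.halted
  · rw [State.report_of_halted _ _ h]
  · rw [State.report_of_not_halted _ _ h]

theorem State.report_counter : (S.report i ξ).counter = S.counter := by
  by_cases h : S.halted
  · rw [State.report_of_halted _ _ h]
  · rw [State.report_of_not_halted _ _ h]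

theorem State.report_level : (S.report i ξ).level = S.level := by
  by_cases h : S.halted
  · rw [State.report_of_halted _ _ h]
  · rw [State.report_of_not_halted _ _ h]

theorem State.report_d : (S.report i ξ).d = S.d := by
  by_cases h : S.halted
  · rw [State.report_of_halted _ _ h]
  · rw [State.report_of_not_halted _ _ h]

theorem State.report_counter0 (h : ¬S.halted) :
    (S.report i ξ).counter0 = S.counter0.feed (S.reportItem i) ξ := by
  rw [State.report_of_not_halted _ _ h]

theorem State.report_μ_of_ne {i' : Fin q.n} (hi : i' ≠ i) : (S.report i ξ).μ i' = S.μ i' := by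
  by_cases h : S.halted
  · rw [State.report_of_halted _ _ h]
  · rw [State.report_of_not_halted _ _ h]
    dsimp only
    split_ifs <;> simp [hi]

theorem State.report_μ_self (h : ¬S.halted) :
    open scoped Classical in
    (S.report i ξ).μ i = if S.Outbid i then .unmatched else S.μ i := by
  rw [State.report_of_not_halted _ _ h]
  dsimp only
  split_ifs <;> simp

theorem State.reportItem_eq_zero_or_one : S.reportItem i = 0 ∨ S.reportItem i = 1 := by
  unfold State.reportItem; split_ifs <;> simp

theorem haltTest_of_not_halted {S S' : q.State} (h : ¬(q.haltTest S S').halted) :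
    q.haltTest S S' = S' ∧ ¬S'.halted := by
  unfold haltTest at h ⊢
  split_ifs at h ⊢ with h1 h2
  · exact ⟨rfl, h⟩
  · exact absurd trivial h
  · exact ⟨rfl, h⟩

theorem haltTest_of_halted {S S' : q.State} (h : S'.halted) : q.haltTest S S' = S' := by
  rw [haltTest, if_pos h]

end Turns

section Driven

variable {q : PMatchParams} {sel : ℕ → Fin q.n → UnitDemand q.k → (Fin q.k → ℝ) → Fin q.k}
  {v : Fin q.n → UnitDemand q.k} {η : q.Noise}

theorem proposeState_zero (r : Fin q.rounds) :
    q.proposeState sel v η r 0 = q.drivenRounds sel v η r := rfl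

theorem proposeState_succ (r : Fin q.rounds) (i : Fin q.n) :
    q.proposeState sel v η r (i + 1) = (q.proposeState sel v η r i).propose sel v r i
      fun j => η (some j, r, i) - (q.proposeState sel v η r i).goodSum sel r i (v i) j := by
  unfold proposeState
  rw [drivenProposals, dif_pos i.2]

theorem reportState_succ (r : Fin q.rounds) (i : Fin q.n) :
    q.reportState sel v η r (i + 1) = (q.reportState sel v η r i).report i
      (η (none, r, i) - (q.reportState sel v η r i).reportSum i) := by
  unfold reportState
  rw [drivenReports, dif_pos i.2]

theorem drivenRounds_succ (r : Fin q.rounds) :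
    q.drivenRounds sel v η (r + 1) =
      q.haltTest (q.drivenRounds sel v η r) (q.reportState sel v η r q.n) := by
  rw [drivenRounds, dif_pos r.2]; rfl

/-- `A` is the invariant between rounds, `P` during proposals, `Q` during reports. `hQA` keeps `A r`
available because the halting test looks back at the start of the round. -/
theorem rounds_induction {R n : ℕ} {A : ℕ → Prop} {P Q : Fin R → ℕ → Prop} (h0 : A 0)
    (hAP : ∀ r : Fin R, A r → P r 0) (hP : ∀ (r : Fin R) (i : Fin n), P r i → P r (i + 1))
    (hPQ : ∀ r, P r n → Q r 0) (hQ : ∀ (r : Fin R) (i : Fin n), Q r i → Q r (i + 1))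
    (hQA : ∀ r : Fin R, A r → Q r n → A (r + 1)) :
    (∀ r ≤ R, A r) ∧ ∀ r, (∀ l ≤ n, P r l) ∧ ∀ l ≤ n, Q r l := by
  have h1 : ∀ r : Fin R, A r → (∀ l ≤ n, P r l) ∧ ∀ l ≤ n, Q r l := by
    intro r hr
    have hP' : ∀ l ≤ n, P r l := by
      intro l
      induction l with
      | zero => exact fun _ => hAP r hr
      | succ l ih => exact fun hl => hP r ⟨l, hl⟩ (ih (by omega))
    refine ⟨hP', fun l => ?_⟩
    induction l with
    | zero => exact fun _ => hPQ r (hP' n le_rfl)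
    | succ l ih => exact fun hl => hQ r ⟨l, hl⟩ (ih (by omega))
  have h2 : ∀ r ≤ R, A r := by
    intro r
    induction r with
    | zero => exact fun _ => h0
    | succ r ih => 
      intro hr
      exact hQA ⟨r, hr⟩ (ih (by omega)) ((h1 ⟨r, hr⟩ (ih (by omega))).2 n le_rfl)
  exact ⟨h2, fun r => h1 r (h2 r r.2.le)⟩

/-! ### Streams -/

variable (q sel v η)

/-- The stream fed to the counter of good `j` along the driven run. -/
noncomputable def bidStream (j : Fin q.k) (u : ℕ) : ℝ :=
  if h : u / q.n < q.rounds ∧ u % q.n < q.n then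
    (q.proposeState sel v η ⟨u / q.n, h.1⟩ (u % q.n)).bidItem sel (u / q.n) ⟨u % q.n, h.2⟩
      (v ⟨u % q.n, h.2⟩) j
  else 0

/-- The stream fed to `counter(0)` along the driven run. -/
noncomputable def reportStream (u : ℕ) : ℝ :=
  if h : u / q.n < q.rounds ∧ u % q.n < q.n then
    (q.reportState sel v η ⟨u / q.n, h.1⟩ (u % q.n)).reportItem ⟨u % q.n, h.2⟩
  else 0

variable {q sel v η}

theorem mul_add_div_mod (r : ℕ) (i : Fin q.n) :
    (q.n * r + i) / q.n = r ∧ (q.n * r + i) % q.n = i := by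
  have hn : 0 < q.n := i.pos
  rw [Nat.mul_add_div hn, Nat.mul_add_mod, Nat.div_eq_of_lt i.2, Nat.mod_eq_of_lt i.2]
  exact ⟨rfl, rfl⟩

theorem bidStream_mul_add (r : Fin q.rounds) (i : Fin q.n) (j : Fin q.k) :
    q.bidStream sel v η j (q.n * r + i) =
      (q.proposeState sel v η r i).bidItem sel r i (v i) j := by
  obtain ⟨h1, h2⟩ := mul_add_div_mod r i
  rw [bidStream, dif_pos (by rw [h1, h2]; exact ⟨r.2, i.2⟩)]
  simp only [h1, h2, Fin.eta]

theorem reportStream_mul_add (r : Fin q.rounds) (i : Fin q.n) :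
    q.reportStream sel v η (q.n * r + i) = (q.reportState sel v η r i).reportItem i := by
  obtain ⟨h1, h2⟩ := mul_add_div_mod r i
  rw [reportStream, dif_pos (by rw [h1, h2]; exact ⟨r.2, i.2⟩)]
  simp only [h1, h2, Fin.eta]

theorem bidStream_eq_zero_or_one (j : Fin q.k) (u : ℕ) :
    q.bidStream sel v η j u = 0 ∨ q.bidStream sel v η j u = 1 := by
  unfold bidStream
  split_ifs
  · exact State.bidItem_eq_zero_or_one _ _
  · exact Or.inl rfl

theorem reportStream_eq_zero_or_one (u : ℕ) :
    q.reportStream sel v η u = 0 ∨ q.reportStream sel v η u = 1 := by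
  unfold reportStream
  split_ifs
  · exact State.reportItem_eq_zero_or_one
  · exact Or.inl rfl

-- Restricted to states that have not halted: afterwards the counters stop while the nominal time n
-- r + l moves on.
variable (sel v η) in
theorem tracks_driven :
    (∀ r ≤ q.rounds, ¬(q.drivenRounds sel v η r).halted →
      (∀ j, ((q.drivenRounds sel v η r).counter j).Tracks (q.bidStream sel v η j) (q.n * r)) ∧
      (q.drivenRounds sel v η r).counter0.Tracks (q.reportStream sel v η) (q.n * r)) ∧
    ∀ r : Fin q.rounds,
      (∀ l ≤ q.n, ¬(q.proposeState sel v η r l).halted →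
        (∀ j, ((q.proposeState sel v η r l).counter j).Tracks
          (q.bidStream sel v η j) (q.n * r + l)) ∧
        (q.proposeState sel v η r l).counter0.Tracks (q.reportStream sel v η) (q.n * r)) ∧
      (∀ l ≤ q.n, ¬(q.reportState sel v η r l).halted →
        (∀ j, ((q.reportState sel v η r l).counter j).Tracks
          (q.bidStream sel v η j) (q.n * r + q.n)) ∧
        (q.reportState sel v η r l).counter0.Tracks
          (q.reportStream sel v η) (q.n * r + l)) := by
  refine rounds_induction ?_ (fun r h => h) ?_ (fun r h => h) ?_ ?_
  · exact fun _ => ⟨fun j => CounterState.tracks_init _, CounterState.tracks_init _⟩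
  · intro r i ih h
    rw [proposeState_succ, State.propose_halted] at h
    rw [proposeState_succ, State.propose_counter0]
    refine ⟨fun j => ?_, (ih h).2⟩
    rw [State.propose_counter h, ← bidStream_mul_add]
    exact ((ih h).1 j).feed _
  · intro r i ih h
    rw [reportState_succ, State.report_halted] at h
    rw [reportState_succ, State.report_counter, State.report_counter0 h, ← reportStream_mul_add]
    exact ⟨(ih h).1, (ih h).2.feed _⟩
  · intro r _ ih h
    rw [drivenRounds_succ] at h ⊢
    obtain ⟨h1, h2⟩ := haltTest_of_not_halted h
    rw [h1, Nat.mul_succ]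
    exact ih h2

theorem drivenSums_some (j : Fin q.k) (r : Fin q.rounds) (i : Fin q.n) :
    open scoped Classical in
    q.drivenSums sel v η (some j, r, i) = if (q.proposeState sel v η r i).halted then 0 else
      ∑ u ∈ dyadicBlock (q.n * r + i + 1), q.bidStream sel v η j u := by
  rw [drivenSums, State.goodSum]
  split_ifs with h
  · rfl
  · have ht := (((tracks_driven sel v η).2 r).1 i i.2.le h).1 j
    rw [← ht.sum_a_add, ht.1, bidStream_mul_add]

theorem drivenSums_none (r : Fin q.rounds) (i : Fin q.n) :
    open scoped Classical in
    q.drivenSums sel v η (none, r, i) = if (q.reportState sel v η r i).halted ∨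
        ¬UsedAtRoundEnd q.n (q.n * r + i + 1) then 0 else
      ∑ u ∈ dyadicBlock (q.n * r + i + 1), q.reportStream sel v η u := by
  rw [drivenSums, State.reportSum]
  by_cases h : (q.reportState sel v η r i).halted
  · rw [if_pos (Or.inl h), if_pos (Or.inl h)]
  · have ht := (((tracks_driven sel v η).2 r).2 i i.2.le h).2
    rw [← ht.sum_a_add, ht.1, reportStream_mul_add]

theorem exists_int_drivenSums_eq (c : Option (Fin q.k) × Fin q.rounds × Fin q.n) :
    ∃ z : ℤ, q.drivenSums sel v η c = z := by
  have hsum : ∀ (s : Finset ℕ) (f : ℕ → ℝ), (∀ u, f u = 0 ∨ f u = 1) →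
      ∃ z : ℤ, ∑ u ∈ s, f u = z := by
    intro s f hf
    have : ∀ u, ∃ z : ℤ, f u = z := fun u => by
      rcases hf u with h | h
      · exact ⟨0, by simp [h]⟩
      · exact ⟨1, by simp [h]⟩
    choose g hg using this
    exact ⟨∑ u ∈ s, g u, by simp [hg]⟩
  obtain ⟨_ | j, r, i⟩ := c
  · rw [drivenSums_none]
    split_ifs
    · exact ⟨0, by simp⟩
    · exact hsum _ _ reportStream_eq_zero_or_one
  · rw [drivenSums_some]
    split_ifs
    · exact ⟨0, by simp⟩
    · exact hsum _ _ (bidStream_eq_zero_or_one j)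

/-- A bidder bids in a round only if she was outbid in the round before. -/
theorem sum_bidStream_le_reportStream {r : ℕ} (hr : r + 1 < q.rounds) (i : Fin q.n) :
    ∑ j, q.bidStream sel v η j (q.n * (r + 1) + i) ≤ q.reportStream sel v η (q.n * r + i) := by
  have e1 := fun j => bidStream_mul_add (sel := sel) (v := v) (η := η) ⟨r + 1, hr⟩ i j
  have e2 := reportStream_mul_add (sel := sel) (v := v) (η := η) ⟨r, by omega⟩ i
  simp only at e1 e2
  simp only [e1, e2]
  rcases (q.reportState sel v η ⟨r, by omega⟩ i).reportItem_eq_zero_or_one (i := i) with h0 | h0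
  swap
  · rw [h0]; exact State.sum_bidItem_le_one _
  rw [h0]
  refine le_of_eq (Finset.sum_eq_zero fun j _ => State.bidItem_eq_zero _ _ ?_)
  -- Without a report in round r she stays matched or at ⊥ from her turn in that round, through the
  -- reports and the halting test, until her next turn.
  have hP : ∀ l, (i : ℕ) + 1 ≤ l → l ≤ q.n →
      ¬(q.proposeState sel v η ⟨r, by omega⟩ l).halted →
      (q.proposeState sel v η ⟨r, by omega⟩ l).μ i ≠ .unmatched := by
    intro l hl
    induction l, hl using Nat.le_induction with
    | base =>
      intro _ h
      rw [proposeState_succ, State.propose_halted] at h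
      rw [proposeState_succ]
      exact State.propose_μ_self_ne_unmatched h
    | succ l hl ih =>
      intro hl' h
      have e := proposeState_succ (sel := sel) (v := v) (η := η) ⟨r, by omega⟩ ⟨l, hl'⟩
      simp only at e
      rw [e, State.propose_halted] at h
      rw [e, State.propose_μ_of_ne (by rw [ne_eq, Fin.ext_iff]; dsimp only; omega)]
      exact ih (by omega) h
  have hQ : ∀ l ≤ q.n, ¬(q.reportState sel v η ⟨r, by omega⟩ l).halted →
      (q.reportState sel v η ⟨r, by omega⟩ l).μ i ≠ .unmatched := by
    intro l
    induction l with
    | zero => intro _; exact hP q.n i.2 le_rfl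
    | succ l ih =>
      intro hl' h
      have e := reportState_succ (sel := sel) (v := v) (η := η) ⟨r, by omega⟩ ⟨l, hl'⟩
      simp only at e
      rw [e, State.report_halted] at h
      rw [e]
      by_cases hil : i = ⟨l, hl'⟩
      · subst hil
        rw [State.report_μ_self h, if_neg]
        · exact ih (by omega) h
        · intro ho
          rw [State.reportItem, if_pos ⟨h, ho⟩] at h0
          exact one_ne_zero h0
      · rw [State.report_μ_of_ne hil]
        exact ih (by omega) h
  have hP' : ∀ l ≤ (i : ℕ), ¬(q.proposeState sel v η ⟨r + 1, hr⟩ l).halted →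
      (q.proposeState sel v η ⟨r + 1, hr⟩ l).μ i ≠ .unmatched := by
    intro l
    induction l with
    | zero =>
      intro _ h
      rw [proposeState_zero] at h ⊢
      have e := drivenRounds_succ (sel := sel) (v := v) (η := η) ⟨r, by omega⟩
      simp only at e
      simp only [e] at h ⊢
      obtain ⟨h1, h2⟩ := haltTest_of_not_halted h
      rw [h1]
      exact hQ _ le_rfl h2
    | succ l ih =>
      intro hl h
      have e := proposeState_succ (sel := sel) (v := v) (η := η) ⟨r + 1, hr⟩ ⟨l, by omega⟩
      simp only at e
      rw [e, State.propose_halted] at h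
      rw [e, State.propose_μ_of_ne (by rw [ne_eq, Fin.ext_iff]; dsimp only; omega)]
      exact ih (by omega) h
  exact hP' i le_rfl

end Driven

end PMatchParams

/-! ### Driven runs on neighbouring databases. -/

namespace PMatchParams

/-- Two states which differ only in the private data of bidder `i₀`, in exact partial sums, and in
those noisy partial sums of `counter(0)` which no reading at the end of a round uses. -/
structure State.AgreeExcept {q : PMatchParams} (i₀ : Fin q.n) (S S' : q.State) : Prop where
  halted : S.halted ↔ S'.halted
  level : S.level = S'.level
  counter : ∀ j, (S.counter j).Agree (S'.counter j)
  time : S.counter0.time = S'.counter0.time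
  ahat : ∀ l, S.counter0.time.testBit l = true →
    UsedAtRoundEnd q.n (2 ^ l * (S.counter0.time / 2 ^ l)) → S.counter0.ahat l = S'.counter0.ahat l
  -- After halting, `tracks_driven` no longer places the counter at a round end, so equality of the
  -- readings is carried along.
  reading : S.halted → S.counter0.reading = S'.counter0.reading
  μ : ∀ i, i ≠ i₀ → S.μ i = S'.μ i
  d : ∀ i, i ≠ i₀ → S.d i = S'.d i

namespace State.AgreeExcept

variable {q : PMatchParams} {i₀ : Fin q.n} {S S' : q.State}
  {sel : ℕ → Fin q.n → UnitDemand q.k → (Fin q.k → ℝ) → Fin q.k}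
  {v v' : Fin q.n → UnitDemand q.k}

/-- At a round end every sum entering the reading counts as used, hence agrees. -/
theorem reading_eq_of_time_eq (h : S.AgreeExcept i₀ S') {r : ℕ} (ht : S.counter0.time = q.n * r) :
    S.counter0.reading = S'.counter0.reading := by
  rw [CounterState.reading, CounterState.reading, ← h.time]
  refine Finset.sum_congr rfl fun l hl => h.ahat l (Finset.mem_filter.1 hl).2 ⟨r, ?_⟩
  rw [← ht]
  exact isUsedAt_of_testBit (Finset.mem_filter.1 hl).2

theorem propose (h : S.AgreeExcept i₀ S') (hv : ∀ i, i ≠ i₀ → v i = v' i) (r : ℕ) (i : Fin q.n)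
    (ξ : Fin q.k → ℝ) :
    (S.propose sel v r i fun j => ξ j - S.goodSum sel r i (v i) j).AgreeExcept i₀
      (S'.propose sel v' r i fun j => ξ j - S'.goodSum sel r i (v' i) j) := by
  by_cases hh : S.halted
  · rwa [propose_of_halted _ _ _ _ _ hh, propose_of_halted _ _ _ _ _ (h.halted.1 hh)]
  · have hh' := mt h.halted.2 hh
    have hc : ∀ j, ((S.propose sel v r i fun j => ξ j - S.goodSum sel r i (v i) j).counter j).Agree
        ((S'.propose sel v' r i fun j => ξ j - S'.goodSum sel r i (v' i) j).counter j) := by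
      intro j
      rw [propose_counter hh, propose_counter hh', goodSum, goodSum, if_neg hh, if_neg hh']
      exact (h.counter j).feed_sub _ _ _
    refine ⟨?_, ?_, hc, ?_, ?_, ?_, ?_, ?_⟩
    · rw [propose_halted, propose_halted]; exact h.halted
    · funext j
      rw [propose_level hh, propose_level hh', (hc j).reading_eq, h.level]
    · rw [propose_counter0, propose_counter0]; exact h.time
    · rw [propose_counter0, propose_counter0]; exact h.ahat
    · rw [propose_counter0, propose_counter0, propose_halted]; exact h.reading
    · intro i' hi'
      by_cases e : i' = i
      · subst e
        rw [propose_μ_self hh, propose_μ_self hh', h.μ i' hi', hv i' hi',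
          (bidItem_congr h.halted h.level (h.μ i' hi')).2]
      · rw [propose_μ_of_ne e, propose_μ_of_ne e, h.μ i' hi']
    · intro i' hi'
      by_cases e : i' = i
      · subst e
        rw [propose_d_self hh, propose_d_self hh', hv i' hi', h.d i' hi',
          (bidItem_congr h.halted h.level (h.μ i' hi')).2]
        rcases S'.bidGood sel r i' (v' i') with _ | j
        · rfl
        · exact (h.counter j).reading_eq
      · rw [propose_d_of_ne e, propose_d_of_ne e, h.d i' hi']

theorem outbid_iff (h : S.AgreeExcept i₀ S') {i : Fin q.n} (hi : i ≠ i₀) :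
    S.Outbid i ↔ S'.Outbid i := by
  simp only [Outbid, h.μ i hi, h.d i hi, fun j => (h.counter j).reading_eq]

theorem reportItem_eq (h : S.AgreeExcept i₀ S') {i : Fin q.n} (hi : i ≠ i₀) :
    S.reportItem i = S'.reportItem i := by
  rw [reportItem, reportItem, propext h.halted, propext (h.outbid_iff hi)]

theorem report (h : S.AgreeExcept i₀ S') (i : Fin q.n) (ξ : ℝ) :
    (S.report i (ξ - S.reportSum i)).AgreeExcept i₀ (S'.report i (ξ - S'.reportSum i)) := by
  by_cases hh : S.halted
  · rwa [report_of_halted _ _ hh, report_of_halted _ _ (h.halted.1 hh)]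
  · have hh' := mt h.halted.2 hh
    refine ⟨?_, ?_, ?_, ?_, ?_, ?_, ?_, ?_⟩
    · rw [report_halted, report_halted]; exact h.halted
    · rw [report_level, report_level]; exact h.level
    · rw [report_counter, report_counter]; exact h.counter
    · rw [report_counter0 hh, report_counter0 hh']
      simp [CounterState.feed, h.time]
    · intro l hl hu
      rw [report_counter0 hh] at hl hu ⊢
      rw [report_counter0 hh']
      have ht : (S.counter0.feed (S.reportItem i) (ξ - S.reportSum i)).time =
          S.counter0.time + 1 := rfl
      rw [ht] at hl hu
      have hbit := hl
      rw [Nat.testBit_eq_decide_div_mod_eq, decide_eq_true_eq] at hbit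
      -- Levels below the new one are cleared; at the new one both runs store ξ, as the sum is used;
      -- levels above keep their sum and its creation time.
      rcases lt_trichotomy l (padicValNat 2 (S.counter0.time + 1)) with h1 | h1 | h1
      · simp [CounterState.feed, ← h.time, h1]
      · rw [h1, two_pow_mul_div_of_lt_padicValNat le_rfl] at hu
        have e : ¬(S.halted ∨ ¬UsedAtRoundEnd q.n (S.counter0.time + 1)) := by
          simp [hh, hu]
        have e' : ¬(S'.halted ∨ ¬UsedAtRoundEnd q.n (S'.counter0.time + 1)) := by
          simp [hh', ← h.time, hu]
        rw [reportSum, reportSum, if_neg e, if_neg e', CounterState.feed_sub_ahat,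
          CounterState.feed_sub_ahat, ← h.time, h1]
        simp
      · have hd := succ_div_two_pow_of_padicValNat_lt h1
        rw [hd] at hu hbit
        have key := h.ahat l (by rw [Nat.testBit_eq_decide_div_mod_eq, decide_eq_true_eq, hbit]) hu
        simp [CounterState.feed, ← h.time, h1.not_gt, h1.ne', key]
    · rw [report_halted]; exact fun h => absurd h hh
    · intro i' hi'
      by_cases e : i' = i
      · subst e
        rw [report_μ_self hh, report_μ_self hh', propext (h.outbid_iff hi'), h.μ i' hi']
      · rw [report_μ_of_ne e, report_μ_of_ne e, h.μ i' hi']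
    · rw [report_d, report_d]; exact h.d

theorem haltTest {S₀ S₀' : q.State} (h : S.AgreeExcept i₀ S')
    (h₀ : S₀.counter0.reading = S₀'.counter0.reading)
    (hr : S.counter0.reading = S'.counter0.reading) :
    (q.haltTest S₀ S).AgreeExcept i₀ (q.haltTest S₀' S') ∧
      (q.haltTest S₀ S).counter0.reading = (q.haltTest S₀' S').counter0.reading := by
  by_cases hh : S.halted
  · rw [haltTest_of_halted hh, haltTest_of_halted (h.halted.1 hh)]
    exact ⟨h, hr⟩
  · have hh' := mt h.halted.2 hh
    rw [PMatchParams.haltTest, PMatchParams.haltTest, if_neg hh, if_neg hh', h₀, hr]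
    split_ifs
    · refine ⟨⟨Iff.rfl, h.level, h.counter, h.time, h.ahat, fun _ => hr, fun i hi => ?_, h.d⟩, hr⟩
      simp only [h.μ i hi]
    · exact ⟨h, hr⟩

end State.AgreeExcept

section Driven

variable {q : PMatchParams} {sel : ℕ → Fin q.n → UnitDemand q.k → (Fin q.k → ℝ) → Fin q.k}
  {v v' : Fin q.n → UnitDemand q.k} {i₀ : Fin q.n}

theorem agreeExcept_driven (hv : ∀ i, i ≠ i₀ → v i = v' i) (η : q.Noise) :
    (∀ r ≤ q.rounds, (q.drivenRounds sel v η r).AgreeExcept i₀ (q.drivenRounds sel v' η r) ∧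
      (q.drivenRounds sel v η r).counter0.reading = (q.drivenRounds sel v' η r).counter0.reading) ∧
    ∀ r, (∀ l ≤ q.n, (q.proposeState sel v η r l).AgreeExcept i₀ (q.proposeState sel v' η r l)) ∧
      ∀ l ≤ q.n, (q.reportState sel v η r l).AgreeExcept i₀ (q.reportState sel v' η r l) := by
  refine rounds_induction ?_ (fun r h => h.1) ?_ (fun r h => h) ?_ ?_
  · exact ⟨⟨Iff.rfl, rfl, fun _ => ⟨rfl, rfl⟩, rfl, fun _ _ _ => rfl, fun _ => rfl,
      fun _ _ => rfl, fun _ _ => rfl⟩, rfl⟩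
  · intro r i ih
    rw [proposeState_succ, proposeState_succ]
    exact ih.propose hv r i _
  · intro r i ih
    rw [reportState_succ, reportState_succ]
    exact ih.report i _
  · intro r h₀ ih
    rw [drivenRounds_succ, drivenRounds_succ]
    refine ih.haltTest h₀.2 ?_
    by_cases hh : (q.reportState sel v η r q.n).halted
    · exact ih.reading hh
    · refine ih.reading_eq_of_time_eq (r := r + 1) ?_
      rw [(((tracks_driven sel v η).2 r).2 _ le_rfl hh).2.1, Nat.mul_succ]

theorem drivenReleased_congr (hv : ∀ i, i ≠ i₀ → v i = v' i) :
    q.drivenReleased sel v = q.drivenReleased sel v' := by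
  funext η
  obtain ⟨h1, h2⟩ := agreeExcept_driven (sel := sel) hv η
  refine Prod.ext ?_ ?_
  · funext r i j
    simp only [drivenReleased, State.price, ((h2 r).1 (i + 1) i.2).level]
  · funext r
    exact (h1 (r + 1) r.2).2

theorem bidStream_congr (hv : ∀ i, i ≠ i₀ → v i = v' i) (η : q.Noise) (j : Fin q.k) {u : ℕ}
    (hu : u % q.n ≠ i₀) : q.bidStream sel v η j u = q.bidStream sel v' η j u := by
  unfold bidStream
  split_ifs with h
  · have hi : (⟨u % q.n, h.2⟩ : Fin q.n) ≠ i₀ := fun e => hu (congrArg Fin.val e)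
    have hs := ((agreeExcept_driven (sel := sel) hv η).2 ⟨u / q.n, h.1⟩).1 (u % q.n) h.2.le
    rw [hv _ hi, (State.bidItem_congr hs.halted hs.level (hs.μ _ hi)).1]
  · rfl

theorem reportStream_congr (hv : ∀ i, i ≠ i₀ → v i = v' i) (η : q.Noise) {u : ℕ}
    (hu : u % q.n ≠ i₀) : q.reportStream sel v η u = q.reportStream sel v' η u := by
  unfold reportStream
  split_ifs with h
  · exact (((agreeExcept_driven (sel := sel) hv η).2 ⟨u / q.n, h.1⟩).2 (u % q.n)
      h.2.le).reportItem_eq fun e => hu (congrArg Fin.val e)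
  · rfl

end Driven

/-! ### The privacy budget -/

theorem sum_prod_eq_sum_range (R n : ℕ) (F : ℕ → ℝ) :
    ∑ c : Fin R × Fin n, F (n * c.1 + c.2) = ∑ x ∈ Finset.range (n * R), F x := by
  rw [mul_comm n R, ← Fin.sum_univ_eq_sum_range, ← finProdFinEquiv.sum_comp]
  refine Finset.sum_congr rfl fun c _ => ?_
  rw [finProdFinEquiv_apply_val, add_comm]

/-- Exchange of summation: δ lives on the positions of one bidder, and each is counted once per
admissible block containing it. -/
theorem sum_abs_sum_dyadicBlock_le {n R i : ℕ} (hi : i < n) {δ : ℕ → ℝ}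
    (hδ : ∀ u, u % n ≠ i → δ u = 0) (p : ℕ → Prop) [DecidablePred p] :
    ∑ c : Fin R × Fin n, (if p (n * c.1 + c.2 + 1) then
        |∑ u ∈ dyadicBlock (n * c.1 + c.2 + 1), δ u| else 0) ≤
      ∑ r ∈ Finset.range R,
        ((Finset.Icc 1 (n * R)).filter fun t => p t ∧ n * r + i ∈ dyadicBlock t).card *
          |δ (n * r + i)| := by
  set N := n * R
  calc ∑ c : Fin R × Fin n, (if p (n * c.1 + c.2 + 1) then
        |∑ u ∈ dyadicBlock (n * c.1 + c.2 + 1), δ u| else 0)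
      = ∑ x ∈ Finset.range N, if p (x + 1) then |∑ u ∈ dyadicBlock (x + 1), δ u| else 0 :=
        sum_prod_eq_sum_range R n fun x =>
          if p (x + 1) then |∑ u ∈ dyadicBlock (x + 1), δ u| else 0
    _ = ∑ t ∈ Finset.Icc 1 N, if p t then |∑ u ∈ dyadicBlock t, δ u| else 0 := by
        rw [Finset.range_eq_Ico, Finset.sum_Ico_add' (fun t => if p t then
          |∑ u ∈ dyadicBlock t, δ u| else 0) 0 N 1]
        rfl
    _ ≤ ∑ t ∈ Finset.Icc 1 N, ∑ u ∈ Finset.range N,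
          if p t ∧ u ∈ dyadicBlock t then |δ u| else 0 := by
        refine Finset.sum_le_sum fun t ht => ?_
        by_cases hp : p t
        · simp only [hp, if_true, true_and]
          rw [← Finset.sum_filter]
          refine (Finset.abs_sum_le_sum_abs _ _).trans (le_of_eq (Finset.sum_congr ?_ fun _ _ => rfl))
          ext u
          have := Finset.mem_Icc.1 ht
          simp only [dyadicBlock, Finset.mem_Ico, Finset.mem_filter, Finset.mem_range]
          omega
        · simp [hp]
    _ = ∑ u ∈ Finset.range N,
          ((Finset.Icc 1 N).filter fun t => p t ∧ u ∈ dyadicBlock t).card * |δ u| := by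
        rw [Finset.sum_comm]
        refine Finset.sum_congr rfl fun u _ => ?_
        rw [← Finset.sum_filter, Finset.sum_const, nsmul_eq_mul]
    _ = _ := by
        rw [← sum_prod_eq_sum_range R n fun u =>
          ((Finset.Icc 1 N).filter fun t => p t ∧ u ∈ dyadicBlock t).card * |δ u|,
          Fintype.sum_prod_type, ← Fin.sum_univ_eq_sum_range (fun r =>
            (((Finset.Icc 1 N).filter fun t => p t ∧ n * r + i ∈ dyadicBlock t).card : ℝ) *
              |δ (n * r + i)|)]
        refine Finset.sum_congr rfl fun r _ => ?_
        rw [Finset.sum_eq_single ⟨i, hi⟩]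
        · intro c _ hc
          rw [hδ, abs_zero, mul_zero]
          rw [Nat.mul_add_mod, Nat.mod_eq_of_lt c.2]
          exact fun e => hc (Fin.ext e)
        · simp

/-- A sum containing an item of the last round is created after time n(R - 1), so a round end using
it is nR or later. Then it is still in use at nR, and blocks used at the same time are disjoint. -/
theorem card_usedAtRoundEnd_last_le_one {n R i : ℕ} (hR : 1 ≤ R) [DecidablePred (UsedAtRoundEnd n)] :
    ((Finset.Icc 1 (n * R)).filter fun t =>
      UsedAtRoundEnd n t ∧ n * (R - 1) + i ∈ dyadicBlock t).card ≤ 1 := by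
  have key : ∀ t, t ∈ (Finset.Icc 1 (n * R)).filter (fun t =>
      UsedAtRoundEnd n t ∧ n * (R - 1) + i ∈ dyadicBlock t) → IsUsedAt t (n * R) := by
    intro t ht
    obtain ⟨h1, ⟨r, h2, h3⟩, h4⟩ := Finset.mem_filter.1 ht
    have h5 := Finset.mem_Ico.1 h4
    refine ⟨(Finset.mem_Icc.1 h1).2, lt_of_le_of_lt (Nat.mul_le_mul_left n ?_) h3⟩
    by_contra! hc
    have := Nat.mul_le_mul_left n (show r ≤ R - 1 by omega)
    omega
  refine Finset.card_le_one.2 fun t ht t' ht' => ?_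
  exact eq_of_isUsedAt_of_mem_dyadicBlock (key t ht) (key t' ht') (Finset.mem_filter.1 ht).2.2
    (Finset.mem_filter.1 ht').2.2

theorem sum_abs_drivenSums_sub_le {q : PMatchParams}
    (sel : ℕ → Fin q.n → UnitDemand q.k → (Fin q.k → ℝ) → Fin q.k)
    {v v' : Fin q.n → UnitDemand q.k} {i₀ : Fin q.n} (hv : ∀ i, i ≠ i₀ → v i = v' i) {L : ℕ}
    (hR : 8 ≤ q.rounds) (hL : q.n * q.rounds < 2 ^ (L + 1)) (η : q.Noise) :
    ∑ c, |q.drivenSums sel v η c - q.drivenSums sel v' η c| ≤ 2 * q.rounds * L := by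
  classical
  obtain ⟨-, hagree⟩ := agreeExcept_driven (sel := sel) hv η
  set δ : Fin q.k → ℕ → ℝ := fun j u => q.bidStream sel v η j u - q.bidStream sel v' η j u
  set δ₀ : ℕ → ℝ := fun u => q.reportStream sel v η u - q.reportStream sel v' η u
  set V : ℕ → ℝ := fun r => ((Finset.Icc 1 (q.n * q.rounds)).filter fun t =>
    UsedAtRoundEnd q.n t ∧ q.n * r + i₀ ∈ dyadicBlock t).card
  have hgood : ∀ j, ∑ c : Fin q.rounds × Fin q.n,
      |q.drivenSums sel v η (some j, c) - q.drivenSums sel v' η (some j, c)| ≤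
      ∑ r ∈ Finset.range q.rounds, zeroDigits L (q.n * r + i₀) * |δ j (q.n * r + i₀)| := by
    intro j
    have h := sum_abs_sum_dyadicBlock_le (R := q.rounds) i₀.2 (δ := δ j)
      (fun u hu => sub_eq_zero.2 (bidStream_congr hv η j hu)) (fun _ => True)
    refine le_trans (Finset.sum_le_sum fun c _ => ?_) (h.trans (Finset.sum_le_sum fun r _ => ?_))
    · obtain ⟨r, i⟩ := c
      rw [drivenSums_some, drivenSums_some, propext ((hagree r).1 i i.2.le).halted]
      split_ifs
      · simp
      · simp only [δ, Finset.sum_sub_distrib]; exact le_rfl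
    · gcongr
      simpa using card_dyadicBlock_mem_le hL (q.n * r + i₀)
  have hcount : ∑ c : Fin q.rounds × Fin q.n,
      |q.drivenSums sel v η (none, c) - q.drivenSums sel v' η (none, c)| ≤
      ∑ r ∈ Finset.range q.rounds, V r * |δ₀ (q.n * r + i₀)| := by
    have h := sum_abs_sum_dyadicBlock_le (R := q.rounds) i₀.2 (δ := δ₀)
      (fun u hu => sub_eq_zero.2 (reportStream_congr hv η hu)) (UsedAtRoundEnd q.n)
    refine le_trans (Finset.sum_le_sum fun c _ => ?_) h
    obtain ⟨r, i⟩ := c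
    rw [drivenSums_none, drivenSums_none, propext ((hagree r).2 i i.2.le).halted]
    by_cases hu : UsedAtRoundEnd q.n (q.n * r + i + 1)
    · by_cases hh : (q.reportState sel v' η r i).halted
      · simp [hh, hu]
      · simp [hh, hu, δ₀, Finset.sum_sub_distrib]
    · simp [hu]
  have hbudget := weighted_items_le (L := L) hR i₀.2 hL
    (g := fun r => ∑ j, |δ j (q.n * r + i₀)|)
    (e := fun r => q.reportStream sel v η (q.n * r + i₀))
    (e' := fun r => q.reportStream sel v' η (q.n * r + i₀)) (V := V)
    (fun r => reportStream_eq_zero_or_one _) (fun r => reportStream_eq_zero_or_one _) ?_ ?_ ?_ ?_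
  · rw [Fintype.sum_prod_type, Fintype.sum_option]
    refine le_trans (add_le_add hcount (Finset.sum_le_sum fun j _ => hgood j)) ?_
    rw [add_comm, Finset.sum_comm]
    simp only [← Finset.mul_sum]
    exact hbudget
  all_goals
    have habs : ∀ r, ∑ j, |δ j (q.n * r + i₀)| ≤ ∑ j, q.bidStream sel v η j (q.n * r + i₀) +
        ∑ j, q.bidStream sel v' η j (q.n * r + i₀) := by
      intro r
      rw [← Finset.sum_add_distrib]
      refine Finset.sum_le_sum fun j _ => ?_
      simp only [δ]
      rcases bidStream_eq_zero_or_one (sel := sel) (v := v) (η := η) j (q.n * r + i₀) with h | h <;>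
      rcases bidStream_eq_zero_or_one (sel := sel) (v := v') (η := η) j (q.n * r + i₀) with h' | h' <;>
      norm_num [h, h']
  -- No earlier report controls the bids of the first round, but each run makes at most one.
  · have h0 : ∀ v : Fin q.n → UnitDemand q.k, ∑ j, q.bidStream sel v η j (q.n * 0 + i₀) ≤ 1 := by
      intro v
      have e := fun j => bidStream_mul_add (sel := sel) (v := v) (η := η) ⟨0, by omega⟩ i₀ j
      simp only at e
      simp only [e]
      exact State.sum_bidItem_le_one _
    linarith [habs 0, h0 v, h0 v']
  · intro r hr
    exact (habs (r + 1)).trans (add_le_add (sum_bidStream_le_reportStream hr i₀)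
      (sum_bidStream_le_reportStream hr i₀))
  · intro r
    refine Nat.cast_le.2 (le_trans (Finset.card_le_card ?_) (card_dyadicBlock_mem_le hL _))
    exact Finset.monotone_filter_right _ fun t _ h => h.2
  · exact Nat.cast_le_one.2 (card_usedAtRoundEnd_last_le_one (by omega))

end PMatchParams

/-! ### Conclusion. -/

theorem mainTheorem3 (q : PMatchParams) (hα0 : 0 < q.α) (hα1 : q.α ≤ 1)
    (hρ0 : 0 < q.ρ) (hρ1 : q.ρ ≤ 1) (hε : 0 < q.ε) (hγ : 0 < q.γ)
    (sel : ℕ → Fin q.n → UnitDemand q.k → (Fin q.k → ℝ) → Fin q.k)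
    (hsel : q.IsFavouriteRule sel) :
    IsDifferentiallyPrivate q.noiseLaw (q.released sel) q.ε 0 := by
  rintro v v' ⟨i₀, hv⟩ S hS
  have hn : 1 ≤ q.n := i₀.pos
  -- From αρ ≤ 1: the eight rounds that the digit count needs.
  have hT : 8 ≤ q.T := by
    rw [PMatchParams.T, le_div_iff₀ (by positivity)]
    nlinarith [mul_le_one₀ hα1 hρ0.le hρ1]
  have hR : 8 ≤ q.rounds := Nat.le_floor (by exact_mod_cast hT)
  have hRT : (q.rounds : ℝ) ≤ q.T := Nat.floor_le (by linarith)
  set L := Nat.log 2 (q.n * q.rounds)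
  have hN : q.n * q.rounds ≠ 0 := by positivity
  have hn' : (1 : ℝ) ≤ q.n := by exact_mod_cast hn
  have hlog : (L : ℝ) ≤ Real.logb 2 (q.n * q.T) := by
    rw [Real.le_logb_iff_rpow_le (by norm_num) (by nlinarith), Real.rpow_natCast]
    calc (2 : ℝ) ^ L ≤ ((q.n * q.rounds : ℕ) : ℝ) := by exact_mod_cast Nat.pow_log_le_self 2 hN
      _ ≤ q.n * q.T := by push_cast; gcongr
  have hlog0 : 0 < Real.logb 2 (q.n * q.T) := Real.logb_pos (by norm_num) (by nlinarith)
  have hε' : 0 < q.ε' := by rw [PMatchParams.ε']; positivity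
  have hb : 0 < counterScale q.ε' (q.n * q.T) := div_pos hlog0 hε'
  -- The factor 2T in ε' = ε / (2T) absorbs 2R, and the factor log₂(nT) in the noise scale absorbs
  -- L.
  have hbound : 2 * q.rounds * L / counterScale q.ε' (q.n * q.T) ≤ q.ε := by
    rw [counterScale, PMatchParams.ε', div_div_eq_mul_div, div_le_iff₀ hlog0, mul_div_assoc',
      div_le_iff₀ (by linarith)]
    calc 2 * (q.rounds : ℝ) * L * q.ε ≤ 2 * q.T * Real.logb 2 (q.n * q.T) * q.ε := by gcongr
      _ = _ := by ring
  have key := pi_laplaceLaw_image_sub_le hb (PMatchParams.measurable_drivenSums sel v)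
    (PMatchParams.measurable_drivenSums sel v') (fun η => PMatchParams.exists_int_drivenSums_eq)
    (fun η => PMatchParams.exists_int_drivenSums_eq) PMatchParams.sub_drivenSums_injective
    (PMatchParams.sum_abs_drivenSums_sub_le sel hv hR (Nat.lt_pow_succ_log_self (by norm_num) _))
    (PMatchParams.measurable_drivenReleased sel v hS)
  rw [ENNReal.ofReal_zero, add_zero]
  calc q.noiseLaw {ω | q.released sel v ω ∈ S}
      ≤ q.noiseLaw ((fun η => η - q.drivenSums sel v η) '' (q.drivenReleased sel v ⁻¹' S)) := by
        refine measure_mono fun ω hω => ?_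
        obtain ⟨η, rfl⟩ := PMatchParams.sub_drivenSums_surjective (sel := sel) (v := v) ω
        refine ⟨η, ?_, rfl⟩
        rw [Set.mem_preimage, ← PMatchParams.released_sub_drivenSums]
        exact hω
    _ ≤ _ := key
    _ ≤ ENNReal.ofReal (Real.exp q.ε) * q.noiseLaw {ω | q.released sel v' ω ∈ S} := by
        refine mul_le_mul' (by gcongr) (measure_mono ?_)
        rintro _ ⟨η, hη, rfl⟩
        rw [PMatchParams.drivenReleased_congr hv] at hη
        change q.released sel v' (η - q.drivenSums sel v' η) ∈ S
        rw [PMatchParams.released_sub_drivenSums]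
        exact hη
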